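/- A graphon is a symmetric measurable function $g:[0,1]^2\to[0,1]$. Put $$\varepsilon(g)=\int_{[0,1]^2} g\,dx\,dy,\qquad \tau(g)=\int_{[0,1]^3} g(x,y)g(y,z)g(z,x)\,dx\,dy\,dz,$$ $$S(g)=-\tfrac12\int_{[0,1]^2} \bigl(g\ln g+(1-g)\ln(1-g)\bigr)\,dx\,dy .$$ An optimizer at $(\varepsilon,\tau)$ is a graphon that maximizes $S$ among all graphons with edge density $\varepsilon$ and triangle density $\tau$. Reduced graphons are graphons up to rearrangement, with the cut metric $\delta(f,g)=\inf_\phi \sup_{S,T}\bigl|\int_{S\times T}(f(x,y)-g(\phi(x),\phi(y)))\,dx\,dy\bigr|$, where $S,T\subseteq[0,1]$ are measurable and $\phi$ ranges over the invertible measure-preserving maps of $[0,1]$; graphons at distance $0$ are identified. A graphon is of type $B(1,1)$ if, up to rearrangement, it is constant on the blocks of a partition of $[0,1]$ into two sets (podes) of sizes $c,1-c$ with $0<c<1$, with values $p_{11}=a$, $p_{22}=b$, $p_{12}=p_{21}=d$, and it is neither constant ($a=b=d$) nor symmetric under exchange of the podes ($a=b$ and $c=\frac12$). It is of type $B(2,1)$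 or $C(1,2)$ (the same class of graphons) if it is given in this way by three podes of sizes $\frac c2,\frac c2,1-c$ with $0<c<1$, and values $p_{11}=p_{22}=a_-$, $p_{12}=p_{21}=a_+$, $p_{13}=p_{31}=p_{23}=p_{32}=d$, $p_{33}=b$, where $a_+\neq a_-$, and the three podes are not all interchangeable (that is, not both $c=\frac23$ and $b=a_-,\ d=a_+$). A $B(1,1)$ phase (respectively a $B(2,1)$ or $C(1,2)$ phase) is a nonempty connected open set of points $(\varepsilon,\tau)$ with $\tau<\varepsilon^3$ at each of which the optimizer is unique as a reduced graphon and is of type $B(1,1)$ (respectively of type $B(2,1)$ or $C(1,2)$), and on which the optimizer varies analytically, i.e. the values and pode sizes can be chosen, locally, as real-analytic functions of $(\varepsilon,\tau)$. There is a continuous transition at $(\varepsilon_0,\tau_0)$ from a $B(1,1)$ phase $U$ to a $B(2,1)$ or $C(1,2)$ phase $V$ if some graphon $g_0$ of type $B(1,1)$ is the cut-metric limit both of optimizers at a sequence of points of $U$ tending to $(\varepsilon_0,\tau_0)$ and of optimizers at a sequence of points of $V$ tending to $(\varepsilon_0,\tau_0)$. Theorem. There is a finite set $E\subset\mathbb R$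 such that, for every $\varepsilon_0\notin E$ and every $\tau_0$, there is no continuous transition at $(\varepsilon_0,\tau_0)$ from a $B(1,1)$ phase to a $B(2,1)$ or $C(1,2)$ phase. -/

import Mathlib

open MeasureTheory Filter Topology unitInterval

noncomputable section

namespace EdgeTriangle

/-- A graphon: a symmetric measurable function `[0,1]² → [0,1]`. -/
structure IsGraphon (g : I → I → ℝ) : Prop where
  measurable : Measurable (Function.uncurry g)
  symm : ∀ x y, g x y = g y x
  mem_Icc : ∀ x y, g x y ∈ Set.Icc (0 : ℝ) 1

/-- The edge density `ε(g) = ∫ g(x,y) dx dy`. -/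
def edgeDensity (g : I → I → ℝ) : ℝ :=
  ∫ x, ∫ y, g x y

/-- The triangle density `τ(g) = ∫ g(x,y) g(y,z) g(z,x) dx dy dz`. -/
def triangleDensity (g : I → I → ℝ) : ℝ :=
  ∫ x, ∫ y, ∫ z, g x y * g y z * g z x

/-- The graphon entropy
`S(g) = -½ ∫ g log g + (1 - g) log (1 - g) dx dy`, with `0 log 0 = 0`. -/
def entropy (g : I → I → ℝ) : ℝ :=
  -(1 / 2) * ∫ x, ∫ y, (g x y * Real.log (g x y) + (1 - g x y) * Real.log (1 - g x y))

/-- The labelled cut metric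
`d(f,g) = sup_{S,T} |∫_{S × T} (f - g)|`, over measurable `S, T ⊆ [0,1]`. -/
def labelledCutDist (f g : I → I → ℝ) : ℝ :=
  sSup {r : ℝ | ∃ S T : Set I, MeasurableSet S ∧ MeasurableSet T ∧
    r = |∫ x in S, ∫ y in T, (f x y - g x y)|}

/-- The cut metric on reduced graphons: the infimum of the labelled cut metric over all
rearrangements of `[0,1]` by invertible measure-preserving maps. -/
def cutDist (f g : I → I → ℝ) : ℝ :=
  ⨅ φ : {φ : I ≃ᵐ I // MeasurePreserving φ volume volume},
    labelledCutDist f (fun x y => g (φ.1 x) (φ.1 y))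

/-- Two graphons represent the same reduced graphon iff their cut distance vanishes. -/
def Equivalent (f g : I → I → ℝ) : Prop :=
  cutDist f g = 0

/-- `g` maximizes the entropy among all graphons with edge density `p.1` and triangle
density `p.2`. -/
structure IsOptimizer (p : ℝ × ℝ) (g : I → I → ℝ) : Prop where
  isGraphon : IsGraphon g
  edge : edgeDensity g = p.1
  triangle : triangleDensity g = p.2
  maximal : ∀ h, IsGraphon h → edgeDensity h = p.1 → triangleDensity h = p.2 →
    entropy h ≤ entropy g

/-- `g` is the optimizer at `p = (ε, τ)`, unique as a reduced graphon. -/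
def IsUniqueOptimizer (p : ℝ × ℝ) (g : I → I → ℝ) : Prop :=
  IsOptimizer p g ∧ ∀ h, IsOptimizer p h → Equivalent h g

/-- The bipodal graphon with podes `[0,c)` and `[c,1]`, and
`p₁₁ = a`, `p₂₂ = b`, `p₁₂ = p₂₁ = d`. -/
def bipodal (a b c d : ℝ) : I → I → ℝ := fun x y =>
  if (x : ℝ) < c then
    if (y : ℝ) < c then a else d
  else
    if (y : ℝ) < c then d else b

/-- The tripodal graphon with podes `[0,c/2)`, `[c/2,c)` and `[c,1]`, and
`p₁₁ = p₂₂ = am`, `p₁₂ = p₂₁ = ap`, `p₃₃ = b`, and `d` for the remaining entries. -/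
def tripodal (ap am b c d : ℝ) : I → I → ℝ := fun x y =>
  if (x : ℝ) < c then
    if (y : ℝ) < c then
      if ((x : ℝ) < c / 2 ↔ (y : ℝ) < c / 2) then am else ap
    else d
  else
    if (y : ℝ) < c then d else b

/-- The parameters describe a bipodal graphon of type `B(1,1)`: two podes of positive size
which are neither indistinguishable (a constant graphon) nor interchangeable (type `A(2,0)`). -/
structure IsB11 (a b c d : ℝ) : Prop where
  a_mem : a ∈ Set.Icc (0 : ℝ) 1
  b_mem : b ∈ Set.Icc (0 : ℝ) 1
  c_mem : c ∈ Set.Ioo (0 : ℝ) 1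
  d_mem : d ∈ Set.Icc (0 : ℝ) 1
  not_constant : ¬ (a = d ∧ b = d)
  not_A20 : ¬ (a = b ∧ c = 1 / 2)

/-- The parameters describe a tripodal graphon of type `B(2,1)` or `C(1,2)`. These are the same
class of graphons: three different podes, of which exactly two are interchangeable. When
`ap = am` the first two podes merge into one, and the last condition excludes that all three
podes are interchangeable (type `A(3,0)`). -/
structure IsB21orC12 (ap am b c d : ℝ) : Prop where
  ap_mem : ap ∈ Set.Icc (0 : ℝ) 1
  am_mem : am ∈ Set.Icc (0 : ℝ) 1
  b_mem : b ∈ Set.Icc (0 : ℝ) 1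
  c_mem : c ∈ Set.Ioo (0 : ℝ) 1
  d_mem : d ∈ Set.Icc (0 : ℝ) 1
  ne : ap ≠ am
  not_A30 : ¬ (c = 2 / 3 ∧ b = am ∧ d = ap)

/-- A `B(1,1)` phase: a connected open set of points `(ε, τ)` below the Erdős–Rényi curve
`τ = ε³` at which the optimal reduced graphon is unique, is of type `B(1,1)`, and varies
analytically with `(ε, τ)`. -/
structure IsB11Phase (U : Set (ℝ × ℝ)) : Prop where
  isOpen : IsOpen U
  isConnected : IsConnected U
  below : ∀ p ∈ U, p.2 < p.1 ^ 3
  optimal : ∀ p ∈ U, ∃ a b c d : ℝ × ℝ → ℝ,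
    AnalyticAt ℝ a p ∧ AnalyticAt ℝ b p ∧ AnalyticAt ℝ c p ∧ AnalyticAt ℝ d p ∧
    ∀ᶠ q in 𝓝 p, IsB11 (a q) (b q) (c q) (d q) ∧
      IsUniqueOptimizer q (bipodal (a q) (b q) (c q) (d q))

/-- A `B(2,1)` or `C(1,2)` phase: a connected open set of points `(ε, τ)` below the
Erdős–Rényi curve `τ = ε³` at which the optimal reduced graphon is unique, is tripodal with
exactly two interchangeable podes, and varies analytically with `(ε, τ)`. -/
structure IsB21orC12Phase (V : Set (ℝ × ℝ)) : Prop where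
  isOpen : IsOpen V
  isConnected : IsConnected V
  below : ∀ p ∈ V, p.2 < p.1 ^ 3
  optimal : ∀ p ∈ V, ∃ ap am b c d : ℝ × ℝ → ℝ,
    AnalyticAt ℝ ap p ∧ AnalyticAt ℝ am p ∧ AnalyticAt ℝ b p ∧ AnalyticAt ℝ c p ∧
    AnalyticAt ℝ d p ∧
    ∀ᶠ q in 𝓝 p, IsB21orC12 (ap q) (am q) (b q) (c q) (d q) ∧
      IsUniqueOptimizer q (tripodal (ap q) (am q) (b q) (c q) (d q))

/-- `g₀` is a limit, in the cut metric, of optimizers at points of `U` that tend to `p₀`. -/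
def IsLimitOfOptimizers (U : Set (ℝ × ℝ)) (p₀ : ℝ × ℝ) (g₀ : I → I → ℝ) : Prop :=
  ∃ (p : ℕ → ℝ × ℝ) (g : ℕ → I → I → ℝ),
    (∀ n, p n ∈ U) ∧ (∀ n, IsOptimizer (p n) (g n)) ∧
    Tendsto p atTop (𝓝 p₀) ∧ Tendsto (fun n => cutDist (g n) g₀) atTop (𝓝 0)

/-- At `p₀` there is a continuous transition from the `B(1,1)` phase `U` to the phase `V`: some
graphon of type `B(1,1)` can be approached by optimizers both from inside `U` and from inside
`V`, as `(ε, τ) → p₀`. Approach along one sequence on each side is enough, so this holds as soon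
as the optimizer does not jump at `p₀` along some path that leads from `U` to `V`. -/
def IsContinuousTransition (U V : Set (ℝ × ℝ)) (p₀ : ℝ × ℝ) : Prop :=
  ∃ a b c d : ℝ, IsB11 a b c d ∧
    IsLimitOfOptimizers U p₀ (bipodal a b c d) ∧ IsLimitOfOptimizers V p₀ (bipodal a b c d)

end EdgeTriangle

end

noncomputable section

namespace EdgeTriangle

/-! The exceptional set is empty: optimizers in a tripodal phase never approach a graphon of type
B(1,1). Merging two podes makes the triangle multiplier diverge, and the resulting limit is too
rigid to be optimal.

Write H for the binary entropy and call the codegree K of a block the density of 2-paths joining its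
two podes. In a phase the maximal entropy is a differentiable function of the densities, and its
gradient (α, β) gives the equations H'(value) = 2α + 6βK for every block
(`IsB21orC12Phase.exists_isCriticalTripodal`). Below the Erdős–Rényi curve β ≥ 0, since mixing with
the constant graphon of the same edge density does not lower the entropy
(`IsOptimizer.triEntropy_le_entropy`). If the optimizers tend to a B(1,1) graphon, then along a
subsequence all parameters converge and `ap`, `am` have a common limit (`exists_isMergingSequence`).
Subtracting their equations gives H'(am) - H'(ap) = 3βc(am - ap)², while |H'(x) - H'(y)| ≥ |x - y|.
Hence 3βc|am - ap| ≥ 1, and β → ∞ (`IsMergingSequence.tendsto_multiplier`).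

After division by β the entropy disappears from the limiting equations: values inside (0,1) have
equal codegrees, and unequal codegrees push values to 0 or 1
(`IsMergingSequence.isCriticalBipodal`). Entropy returns through global optimality. Splitting a
value a into a ± t costs entropy of order t² but removes c³t³ triangles. So if, along a path of
constant edge density, the triangle count is stationary and the entropy is not, moving by s⁵ and
splitting by s³ gains entropy (s⁵ against s⁶) with fewer triangles (s⁹ against s¹⁰)
(`exists_better_tripodal_of_pos`). In `IsCriticalBipodal.elim` every pattern of values at 0, at 1 or
in between is excluded by codegrees alone, by such a path, or by comparison with a balanced
bipartite graphon. -/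

/-! ### Densities and entropy of tripodal graphons -/

/-- The pode of a tripodal graphon that contains `x`. -/
def podeIndex (c : ℝ) (x : I) : Fin 3 :=
  if (x : ℝ) < c then if (x : ℝ) < c / 2 then 0 else 1 else 2

/-- The sizes of the podes of a tripodal graphon. -/
def podeSize (c : ℝ) : Fin 3 → ℝ := ![c / 2, c / 2, 1 - c]

/-- The values of a tripodal graphon on the blocks. -/
def podeValue (ap am b d : ℝ) : Fin 3 → Fin 3 → ℝ :=
  ![![am, ap, d], ![ap, am, d], ![d, d, b]]

/-- The pode of a bipodal graphon that contains `x`. -/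
def bipodeIndex (c : ℝ) (x : I) : Fin 2 := if (x : ℝ) < c then 0 else 1

/-- The sizes of the podes of a bipodal graphon. -/
def bipodeSize (c : ℝ) : Fin 2 → ℝ := ![c, 1 - c]

/-- The values of a bipodal graphon on the blocks. -/
def bipodeValue (a b d : ℝ) : Fin 2 → Fin 2 → ℝ := ![![a, d], ![d, b]]

lemma tripodal_eq (ap am b c d : ℝ) (x y : I) :
    tripodal ap am b c d x y = podeValue ap am b d (podeIndex c x) (podeIndex c y) := by
  unfold tripodal podeValue podeIndex
  split_ifs <;> simp_all

lemma bipodal_eq (a b c d : ℝ) (x y : I) :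
    bipodal a b c d x y = bipodeValue a b d (bipodeIndex c x) (bipodeIndex c y) := by
  unfold bipodal bipodeValue bipodeIndex
  split_ifs <;> simp_all

lemma measurable_podeIndex (c : ℝ) : Measurable (podeIndex c) := by
  unfold podeIndex
  refine Measurable.ite (measurableSet_lt measurable_subtype_coe measurable_const) ?_
    measurable_const
  exact Measurable.ite (measurableSet_lt measurable_subtype_coe measurable_const)
    measurable_const measurable_const

lemma measurable_bipodeIndex (c : ℝ) : Measurable (bipodeIndex c) := by
  unfold bipodeIndex
  exact Measurable.ite (measurableSet_lt measurable_subtype_coe measurable_const)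
    measurable_const measurable_const

lemma real_volume_podeIndex {c : ℝ} (hc : c ∈ Set.Icc (0 : ℝ) 1) (i : Fin 3) :
    volume.real (podeIndex c ⁻¹' {i}) = podeSize c i := by
  obtain ⟨h0, h1⟩ := hc
  let u : I := ⟨c / 2, by linarith, by linarith⟩
  let v : I := ⟨c, h0, h1⟩
  have e0 : podeIndex c ⁻¹' {0} = Set.Iio u := by
    ext x
    simp only [podeIndex, Set.mem_preimage, Set.mem_singleton_iff, Set.mem_Iio, ← Subtype.coe_lt_coe,
      u]
    split_ifs <;> simp <;> linarith
  have e1 : podeIndex c ⁻¹' {1} = Set.Ico u v := by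
    ext x
    simp only [podeIndex, Set.mem_preimage, Set.mem_singleton_iff, Set.mem_Ico, ← Subtype.coe_lt_coe,
      ← Subtype.coe_le_coe, u, v]
    split_ifs <;> simp_all
  have e2 : podeIndex c ⁻¹' {2} = Set.Ici v := by
    ext x
    simp only [podeIndex, Set.mem_preimage, Set.mem_singleton_iff, Set.mem_Ici,
      ← Subtype.coe_le_coe, v]
    split_ifs <;> simp <;> linarith
  fin_cases i
  · simp only [Fin.zero_eta, e0, measureReal_def, unitInterval.volume_Iio, u, podeSize]
    rw [ENNReal.toReal_ofReal (by linarith)]; simp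
  · simp only [Fin.mk_one, e1, measureReal_def, unitInterval.volume_Ico, u, v, podeSize]
    rw [ENNReal.toReal_ofReal (by linarith)]; simp; ring
  · simp only [Fin.reduceFinMk, e2, measureReal_def, unitInterval.volume_Ici, v, podeSize]
    rw [ENNReal.toReal_ofReal (by linarith)]; simp

lemma real_volume_bipodeIndex {c : ℝ} (hc : c ∈ Set.Icc (0 : ℝ) 1) (i : Fin 2) :
    volume.real (bipodeIndex c ⁻¹' {i}) = bipodeSize c i := by
  obtain ⟨h0, h1⟩ := hc
  let v : I := ⟨c, h0, h1⟩
  have e0 : bipodeIndex c ⁻¹' {0} = Set.Iio v := by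
    ext x
    simp only [bipodeIndex, Set.mem_preimage, Set.mem_singleton_iff, Set.mem_Iio,
      ← Subtype.coe_lt_coe, v]
    split_ifs <;> simp <;> linarith
  have e1 : bipodeIndex c ⁻¹' {1} = Set.Ici v := by
    ext x
    simp only [bipodeIndex, Set.mem_preimage, Set.mem_singleton_iff, Set.mem_Ici,
      ← Subtype.coe_le_coe, v]
    split_ifs <;> simp <;> linarith
  fin_cases i
  · simp only [Fin.zero_eta, e0, measureReal_def, unitInterval.volume_Iio, v, bipodeSize]
    rw [ENNReal.toReal_ofReal (by linarith)]; simp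
  · simp only [Fin.mk_one, e1, measureReal_def, unitInterval.volume_Ici, v, bipodeSize]
    rw [ENNReal.toReal_ofReal (by linarith)]; simp

lemma integral_podeIndex {c : ℝ} (hc : c ∈ Set.Icc (0 : ℝ) 1) (f : Fin 3 → ℝ) :
    ∫ x, f (podeIndex c x) = c / 2 * f 0 + c / 2 * f 1 + (1 - c) * f 2 := by
  have hm := measurable_podeIndex c
  have : IsFiniteMeasure (Measure.map (podeIndex c) volume) :=
    Measure.isFiniteMeasure_map _ _
  rw [← integral_map (f := f) hm.aemeasurable (by fun_prop), integral_fintype .of_finite,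
    Fin.sum_univ_three]
  simp only [map_measureReal_apply hm (MeasurableSet.singleton _), real_volume_podeIndex hc,
    podeSize, smul_eq_mul]
  simp

/-- The edge density of a tripodal graphon. -/
def triEdge (ap am b c d : ℝ) : ℝ :=
  c ^ 2 / 2 * (am + ap) + 2 * c * (1 - c) * d + (1 - c) ^ 2 * b

/-- The triangle density of a tripodal graphon. -/
def triTriangle (ap am b c d : ℝ) : ℝ :=
  c ^ 3 / 8 * ((am + ap) ^ 3 + (am - ap) ^ 3) + 3 / 2 * (1 - c) * c ^ 2 * d ^ 2 * (am + ap) +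
    3 * (1 - c) ^ 2 * c * b * d ^ 2 + (1 - c) ^ 3 * b ^ 3

/-- The entropy of a tripodal graphon. -/
def triEntropy (ap am b c d : ℝ) : ℝ :=
  c ^ 2 / 4 * (Real.binEntropy am + Real.binEntropy ap) + c * (1 - c) * Real.binEntropy d +
    (1 - c) ^ 2 / 2 * Real.binEntropy b

lemma edgeDensity_tripodal {c : ℝ} (hc : c ∈ Set.Icc (0 : ℝ) 1) (ap am b d : ℝ) :
    edgeDensity (tripodal ap am b c d) = triEdge ap am b c d := by
  simp only [edgeDensity, tripodal_eq]
  have h1 : ∀ x : I, ∫ y, podeValue ap am b d (podeIndex c x) (podeIndex c y) =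
      (fun i => c / 2 * podeValue ap am b d i 0 + c / 2 * podeValue ap am b d i 1 +
        (1 - c) * podeValue ap am b d i 2) (podeIndex c x) := fun x =>
    integral_podeIndex hc (fun j => podeValue ap am b d (podeIndex c x) j)
  simp only [h1]
  rw [integral_podeIndex hc (fun i => c / 2 * podeValue ap am b d i 0 +
    c / 2 * podeValue ap am b d i 1 + (1 - c) * podeValue ap am b d i 2)]
  simp [podeValue, triEdge]
  ring

lemma triangleDensity_tripodal {c : ℝ} (hc : c ∈ Set.Icc (0 : ℝ) 1) (ap am b d : ℝ) :
    triangleDensity (tripodal ap am b c d) = triTriangle ap am b c d := by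
  simp only [triangleDensity, tripodal_eq]
  set v := podeValue ap am b d with hv
  let F : Fin 3 → Fin 3 → ℝ := fun i j => c / 2 * (v i j * v j 0 * v 0 i) +
    c / 2 * (v i j * v j 1 * v 1 i) + (1 - c) * (v i j * v j 2 * v 2 i)
  let G : Fin 3 → ℝ := fun i => c / 2 * F i 0 + c / 2 * F i 1 + (1 - c) * F i 2
  have h1 : ∀ x y : I, ∫ z, v (podeIndex c x) (podeIndex c y) * v (podeIndex c y) (podeIndex c z) *
      v (podeIndex c z) (podeIndex c x) = F (podeIndex c x) (podeIndex c y) := fun x y =>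
    integral_podeIndex hc (fun k => v (podeIndex c x) (podeIndex c y) * v (podeIndex c y) k *
      v k (podeIndex c x))
  have h2 : ∀ x : I, ∫ y, F (podeIndex c x) (podeIndex c y) = G (podeIndex c x) := fun x =>
    integral_podeIndex hc (F (podeIndex c x))
  simp only [h1, h2]
  rw [integral_podeIndex hc G]
  simp [G, F, hv, podeValue, triTriangle]
  ring

lemma entropy_tripodal {c : ℝ} (hc : c ∈ Set.Icc (0 : ℝ) 1) (ap am b d : ℝ) :
    entropy (tripodal ap am b c d) = triEntropy ap am b c d := by
  simp only [entropy, tripodal_eq]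
  set v : Fin 3 → Fin 3 → ℝ := fun i j => podeValue ap am b d i j *
    Real.log (podeValue ap am b d i j) + (1 - podeValue ap am b d i j) *
    Real.log (1 - podeValue ap am b d i j) with hv
  have h1 : ∀ x : I, ∫ y, v (podeIndex c x) (podeIndex c y) =
      (fun i => c / 2 * v i 0 + c / 2 * v i 1 + (1 - c) * v i 2) (podeIndex c x) := fun x =>
    integral_podeIndex hc (fun j => v (podeIndex c x) j)
  have h2 := integral_podeIndex hc (fun i => c / 2 * v i 0 + c / 2 * v i 1 + (1 - c) * v i 2)
  simp only [← h1] at h2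
  simp only [hv] at h2
  rw [h2]
  simp [podeValue, triEntropy, Real.binEntropy]
  ring

lemma isGraphon_tripodal {ap am b c d : ℝ} (hap : ap ∈ Set.Icc (0 : ℝ) 1)
    (ham : am ∈ Set.Icc (0 : ℝ) 1) (hb : b ∈ Set.Icc (0 : ℝ) 1) (hd : d ∈ Set.Icc (0 : ℝ) 1) :
    IsGraphon (tripodal ap am b c d) where
  measurable := by
    have h : Function.uncurry (tripodal ap am b c d) = fun z : I × I =>
        (fun w : Fin 3 × Fin 3 => podeValue ap am b d w.1 w.2)
          (podeIndex c z.1, podeIndex c z.2) := by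
      ext z; exact tripodal_eq ..
    rw [h]
    have hm := measurable_podeIndex c
    exact (measurable_of_finite (fun w : Fin 3 × Fin 3 => podeValue ap am b d w.1 w.2)).comp
      ((hm.comp measurable_fst).prodMk (hm.comp measurable_snd))
  symm x y := by
    unfold tripodal
    split_ifs <;> simp_all
  mem_Icc x y := by
    unfold tripodal
    split_ifs <;> assumption

/-! ### Binary entropy -/

/-- The derivative of the binary entropy. -/
def entropySlope (u : ℝ) : ℝ := Real.log (1 - u) - Real.log u

lemma hasDerivAt_binEntropy {u : ℝ} (hu : u ∈ Set.Ioo (0 : ℝ) 1) :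
    HasDerivAt Real.binEntropy (entropySlope u) u :=
  Real.hasDerivAt_binEntropy hu.1.ne' hu.2.ne

/-- The term `-log u` alone decreases at rate 1/u ≥ 1. This uniform bound is what later forces the
multiplier to diverge. -/
lemma sub_le_entropySlope_sub {x y : ℝ} (hx : 0 < x) (hxy : x ≤ y) (hy : y < 1) :
    y - x ≤ entropySlope x - entropySlope y := by
  have hy0 : 0 < y := hx.trans_le hxy
  have h1 : Real.log (1 - y) ≤ Real.log (1 - x) := Real.log_le_log (by linarith) (by linarith)
  have h2 := Real.log_le_sub_one_of_pos (div_pos hx hy0)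
  rw [Real.log_div hx.ne' hy0.ne'] at h2
  have h3 : y - x ≤ 1 - x / y := by
    rw [one_sub_div hy0.ne', le_div_iff₀ hy0]
    nlinarith
  unfold entropySlope
  linarith

lemma abs_sub_le_abs_entropySlope_sub {x y : ℝ} (hx : x ∈ Set.Ioo (0 : ℝ) 1)
    (hy : y ∈ Set.Ioo (0 : ℝ) 1) : |x - y| ≤ |entropySlope x - entropySlope y| := by
  rcases le_total x y with h | h
  · have := sub_le_entropySlope_sub hx.1 h hy.2
    rw [abs_sub_comm, abs_of_nonneg (by linarith)]
    exact this.trans (le_abs_self _)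
  · have := sub_le_entropySlope_sub hy.1 h hx.2
    rw [abs_of_nonneg (by linarith), abs_sub_comm (entropySlope x)]
    exact this.trans (le_abs_self _)

lemma continuousAt_entropySlope {u : ℝ} (hu : u ∈ Set.Ioo (0 : ℝ) 1) :
    ContinuousAt entropySlope u := by
  have h1 := hu.1.ne'
  have h2 : 1 - u ≠ 0 := by linarith [hu.2]
  unfold entropySlope
  fun_prop (disch := assumption)

/-- The price of splitting a value is only quadratic: log x ≤ x - 1 is applied to (a ± t)/a and (1 -
a ± t)/(1 - a), and the terms linear in t cancel in the sum. -/
lemma two_mul_binEntropy_sub_le {a t : ℝ} (h1 : |t| < a) (h2 : |t| < 1 - a) :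
    2 * Real.binEntropy a - 2 * t ^ 2 / (a * (1 - a)) ≤
      Real.binEntropy (a + t) + Real.binEntropy (a - t) := by
  have key : ∀ {a t : ℝ}, |t| < a → a * Real.log a + (a + t) * t / a + t * Real.log a ≥
      (a + t) * Real.log (a + t) := by
    intro a t h
    have ha : 0 < a := (abs_nonneg t).trans_lt h
    have hat : 0 < a + t := by linarith [neg_abs_le t]
    have := Real.log_le_sub_one_of_pos (div_pos hat ha)
    rw [Real.log_div hat.ne' ha.ne'] at this
    have e : (a + t) * t / a = (a + t) * ((a + t) / a - 1) := by field_simp; ring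
    rw [e]
    nlinarith
  have a0 : 0 < a := (abs_nonneg t).trans_lt h1
  have b0 : 0 < 1 - a := (abs_nonneg t).trans_lt h2
  have k1 := key h1
  have k2 := key (t := -t) (by simpa using h1)
  have k3 := key h2
  have k4 := key (t := -t) (by simpa using h2)
  have e : 2 * t ^ 2 / (a * (1 - a)) = (a + t) * t / a + (a + -t) * -t / a +
      ((1 - a + t) * t / (1 - a) + (1 - a + -t) * -t / (1 - a)) := by
    field_simp
    ring
  have n1 : 1 - (a + t) = 1 - a + -t := by ring
  have n2 : 1 - (a - t) = 1 - a + t := by ring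
  have n3 : a - t = a + -t := by ring
  simp only [Real.binEntropy, Real.log_inv, n1, n2, e]
  rw [n3]
  linarith

lemma concaveOn_binEntropy : ConcaveOn ℝ (Set.Icc 0 1) Real.binEntropy :=
  Real.strictConcave_binEntropy.concaveOn

lemma tendsto_entropySlope_of_tendsto_zero {α : Type*} {l : Filter α} {u : α → ℝ}
    (hu : Tendsto u l (𝓝 0)) (hpos : ∀ᶠ n in l, 0 < u n) :
    Tendsto (fun n => entropySlope (u n)) l atTop := by
  have h1 : Tendsto (fun n => -Real.log (u n)) l atTop :=
    tendsto_neg_atBot_atTop.comp (Real.tendsto_log_nhdsGT_zero.comp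
      (tendsto_nhdsWithin_iff.2 ⟨hu, hpos⟩))
  have h2 : Tendsto (fun n => Real.log (1 - u n)) l (𝓝 (Real.log (1 - 0))) :=
    (Real.continuousAt_log (by norm_num)).tendsto.comp (tendsto_const_nhds.sub hu)
  simpa [entropySlope, sub_eq_add_neg] using h2.add_atTop h1

/-! ### Monotonicity of the maximal entropy below the Erdős–Rényi curve -/

/-- Jensen's inequality for the concave binary entropy, the weights being the total areas of the
blocks that carry each value. -/
lemma triEntropy_le {ap am b c d : ℝ} (hap : ap ∈ Set.Icc (0 : ℝ) 1)
    (ham : am ∈ Set.Icc (0 : ℝ) 1) (hb : b ∈ Set.Icc (0 : ℝ) 1) (hc : c ∈ Set.Icc (0 : ℝ) 1)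
    (hd : d ∈ Set.Icc (0 : ℝ) 1) :
    triEntropy ap am b c d ≤ Real.binEntropy (triEdge ap am b c d) / 2 := by
  have hk : 0 ≤ 1 - c := by linarith [hc.2]
  have hc0 := hc.1
  have h := concaveOn_binEntropy.le_map_sum (t := Finset.univ)
    (w := ![c ^ 2 / 2, c ^ 2 / 2, 2 * c * (1 - c), (1 - c) ^ 2]) (p := ![am, ap, d, b])
    (by intro i _; fin_cases i <;> simp <;> positivity)
    (by simp [Fin.sum_univ_four]; ring)
    (by intro i _; fin_cases i <;> simpa)
  simp only [Fin.sum_univ_four, smul_eq_mul] at h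
  simp at h
  have e : triEdge ap am b c d =
      c ^ 2 / 2 * am + c ^ 2 / 2 * ap + 2 * c * (1 - c) * d + (1 - c) ^ 2 * b := by
    unfold triEdge; ring
  rw [e]
  unfold triEntropy
  linarith

lemma triEdge_mem {ap am b c d : ℝ} (hap : ap ∈ Set.Icc (0 : ℝ) 1)
    (ham : am ∈ Set.Icc (0 : ℝ) 1) (hb : b ∈ Set.Icc (0 : ℝ) 1) (hc : c ∈ Set.Icc (0 : ℝ) 1)
    (hd : d ∈ Set.Icc (0 : ℝ) 1) : triEdge ap am b c d ∈ Set.Icc (0 : ℝ) 1 := by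
  have hk : 0 ≤ 1 - c := by linarith [hc.2]
  obtain ⟨h1, h1'⟩ := hap
  obtain ⟨h2, h2'⟩ := ham
  obtain ⟨h3, h3'⟩ := hb
  obtain ⟨h4, h4'⟩ := hd
  have hc0 := hc.1
  unfold triEdge
  constructor
  · positivity
  · have := mul_le_mul_of_nonneg_left h1' (by positivity : 0 ≤ c ^ 2 / 2)
    have := mul_le_mul_of_nonneg_left h2' (by positivity : 0 ≤ c ^ 2 / 2)
    have := mul_le_mul_of_nonneg_left h4' (by positivity : 0 ≤ 2 * c * (1 - c))
    have := mul_le_mul_of_nonneg_left h3' (by positivity : 0 ≤ (1 - c) ^ 2)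
    nlinarith

lemma binEntropy_mix {s e u : ℝ} (hs : s ∈ Set.Icc (0 : ℝ) 1) (he : e ∈ Set.Icc (0 : ℝ) 1)
    (hu : u ∈ Set.Icc (0 : ℝ) 1) :
    (1 - s) * Real.binEntropy u + s * Real.binEntropy e ≤
      Real.binEntropy ((1 - s) * u + s * e) := by
  simpa using concaveOn_binEntropy.2 hu he (by linarith [hs.2]) hs.1 (by ring)

lemma mix_mem {s e u : ℝ} (hs : s ∈ Set.Icc (0 : ℝ) 1) (he : e ∈ Set.Icc (0 : ℝ) 1)
    (hu : u ∈ Set.Icc (0 : ℝ) 1) : (1 - s) * u + s * e ∈ Set.Icc (0 : ℝ) 1 := by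
  simpa using convex_Icc (0 : ℝ) 1 hu he (by linarith [hs.2]) hs.1 (by ring)

/-- Below the Erdős–Rényi curve, an optimizer has at least the entropy of any tripodal graphon with
the same edge density and at most as many triangles. -/
lemma IsOptimizer.triEntropy_le_entropy {p : ℝ × ℝ} {g : I → I → ℝ} (hg : IsOptimizer p g)
    (hp : p.2 ≤ p.1 ^ 3) {ap am b c d : ℝ} (hap : ap ∈ Set.Icc (0 : ℝ) 1)
    (ham : am ∈ Set.Icc (0 : ℝ) 1) (hb : b ∈ Set.Icc (0 : ℝ) 1) (hc : c ∈ Set.Icc (0 : ℝ) 1)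
    (hd : d ∈ Set.Icc (0 : ℝ) 1) (he : triEdge ap am b c d = p.1)
    (ht : triTriangle ap am b c d ≤ p.2) : triEntropy ap am b c d ≤ entropy g := by
  set e := p.1 with hee
  have hem : e ∈ Set.Icc (0 : ℝ) 1 := he ▸ triEdge_mem hap ham hb hc hd
  let m : ℝ → ℝ → ℝ := fun u s => (1 - s) * u + s * e
  -- Mixing with the constant `e` keeps the edge density, and the triangle density ends at e³ ≥
  -- `p.2`, so some mixture is admissible at `p`. Concavity shows that this mixture has at least the
  -- original entropy.
  let f : ℝ → ℝ := fun s => triTriangle (m ap s) (m am s) (m b s) c (m d s)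
  have hf : Continuous f := by
    simp only [f, m, triTriangle]
    fun_prop
  have h0 : f 0 ≤ p.2 := by simpa [f, m] using ht
  have h1 : p.2 ≤ f 1 := by
    have : f 1 = e ^ 3 := by simp [f, m, triTriangle]; ring
    linarith
  obtain ⟨s, hs, hfs⟩ := intermediate_value_Icc zero_le_one hf.continuousOn ⟨h0, h1⟩
  have hedge : triEdge (m ap s) (m am s) (m b s) c (m d s) = e := by
    have : triEdge (m ap s) (m am s) (m b s) c (m d s) =
        (1 - s) * triEdge ap am b c d + s * e := by
      simp only [triEdge, m]; ring
    rw [this, he]; ring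
  have hmax := hg.maximal (tripodal (m ap s) (m am s) (m b s) c (m d s))
    (isGraphon_tripodal (mix_mem hs hem hap) (mix_mem hs hem ham) (mix_mem hs hem hb)
      (mix_mem hs hem hd))
    (by rw [edgeDensity_tripodal hc, hedge]) (by rw [triangleDensity_tripodal hc]; exact hfs)
  rw [entropy_tripodal hc] at hmax
  refine le_trans ?_ hmax
  have hj := triEntropy_le hap ham hb hc hd
  rw [he] at hj
  have hk : 0 ≤ 1 - c := by linarith [hc.2]
  have hc0 := hc.1
  have k1 := mul_le_mul_of_nonneg_left (binEntropy_mix hs hem hap) (by positivity : 0 ≤ c ^ 2 / 4)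
  have k2 := mul_le_mul_of_nonneg_left (binEntropy_mix hs hem ham) (by positivity : 0 ≤ c ^ 2 / 4)
  have k3 := mul_le_mul_of_nonneg_left (binEntropy_mix hs hem hd) (by positivity : 0 ≤ c * (1 - c))
  have k4 := mul_le_mul_of_nonneg_left (binEntropy_mix hs hem hb)
    (by positivity : 0 ≤ (1 - c) ^ 2 / 2)
  have k5 : s * triEntropy ap am b c d ≤ s * (Real.binEntropy e / 2) :=
    mul_le_mul_of_nonneg_left hj hs.1
  have k6 : (1 - s) * triEntropy ap am b c d + s * (Real.binEntropy e / 2) ≤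
      triEntropy (m ap s) (m am s) (m b s) c (m d s) := by
    simp only [triEntropy, m]
    linarith
  linarith

/-! ### Optimizers in a phase take values in the open unit interval -/

lemma binEntropy_le_tangent {x y : ℝ} (hx : x ∈ Set.Icc (0 : ℝ) 1) (hy : y ∈ Set.Ioo (0 : ℝ) 1) :
    Real.binEntropy x ≤ Real.binEntropy y + entropySlope y * (x - y) := by
  have key : ∀ {x y : ℝ}, 0 ≤ x → 0 < y → -(x * Real.log x) ≤ -(x * Real.log y) + (y - x) := by
    intro x y hx hy
    rcases hx.eq_or_lt with rfl | hx
    · simpa using hy.le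
    · have := mul_le_mul_of_nonneg_left (Real.log_le_sub_one_of_pos (div_pos hy hx)) hx.le
      rw [Real.log_div hy.ne' hx.ne', mul_sub, mul_sub, mul_div_cancel₀ _ hx.ne'] at this
      linarith
  have k1 := key hx.1 hy.1
  have k2 := key (sub_nonneg.2 hx.2) (sub_pos.2 hy.2)
  simp only [Real.binEntropy, Real.log_inv, entropySlope]
  linarith

/-- A differentiable `u` with values in [0,1] has a minimum at 0, so its derivative there vanishes
and u(t) ≤ t/4 for small t > 0. The mixture equals t/2, and the infinite slope of the entropy at 0
makes the gain from t/4 to t/2 superlinear. -/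
lemma eventually_mul_le_binEntropy_sub_of_eq_zero {u : ℝ → ℝ} (hu : DifferentiableAt ℝ u 0)
    (hmem : ∀ᶠ t in 𝓝 0, u t ∈ Set.Icc (0 : ℝ) 1) (h0 : u 0 = 0) (M : ℝ) :
    ∀ᶠ t in 𝓝[>] (0 : ℝ), M * t ≤
      Real.binEntropy ((1 - t) * u 0 + t / 2) - Real.binEntropy (u t) := by
  have hmin : IsLocalMin u 0 := hmem.mono fun t ht => by rw [h0]; exact ht.1
  have hd : HasDerivAt u 0 0 := by
    simpa only [hmin.deriv_eq_zero] using hu.hasDerivAt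
  have hsmall := (hasDerivAt_iff_isLittleO.1 hd).def (show (0 : ℝ) < 1 / 4 by norm_num)
  have hslope : Tendsto (fun t : ℝ => entropySlope (t / 2)) (𝓝[>] 0) atTop := by
    apply tendsto_entropySlope_of_tendsto_zero
    · exact tendsto_nhdsWithin_of_tendsto_nhds (Continuous.tendsto' (by fun_prop) _ _ (by simp))
    · filter_upwards [self_mem_nhdsWithin] with t ht
      have : (0 : ℝ) < t := ht
      positivity
  filter_upwards [nhdsWithin_le_nhds hmem, nhdsWithin_le_nhds hsmall, self_mem_nhdsWithin,
    hslope.eventually_ge_atTop (4 * M),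
    nhdsWithin_le_nhds (Iio_mem_nhds (show (0 : ℝ) < 1 by norm_num))] with t h1 h2 h3 h4 h5
  have ht : (0 : ℝ) < t := h3
  have ht1 : t < 1 := h5
  have hut : u t ≤ t / 4 := by
    simp only [h0, sub_zero, smul_zero, Real.norm_eq_abs, abs_of_pos ht] at h2
    linarith [le_abs_self (u t)]
  have k1 : Real.binEntropy (u t) ≤ Real.binEntropy (t / 4) :=
    Real.binEntropy_strictMonoOn.monotoneOn ⟨h1.1, by norm_num; linarith⟩
      ⟨by linarith, by norm_num; linarith⟩ hut
  have k2 := binEntropy_le_tangent (x := t / 4) (y := t / 2) ⟨by linarith, by linarith⟩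
    ⟨by linarith, by linarith⟩
  have k3 : entropySlope (t / 2) * (t / 4 - t / 2) ≤ -(M * t) := by nlinarith
  rw [h0, mul_zero, zero_add]
  linarith

lemma eventually_mul_le_binEntropy_sub {u : ℝ → ℝ} (hu : DifferentiableAt ℝ u 0)
    (hmem : ∀ᶠ t in 𝓝 0, u t ∈ Set.Icc (0 : ℝ) 1) (h0 : u 0 ∉ Set.Ioo (0 : ℝ) 1) (M : ℝ) :
    ∀ᶠ t in 𝓝[>] (0 : ℝ), M * t ≤
      Real.binEntropy ((1 - t) * u 0 + t / 2) - Real.binEntropy (u t) := by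
  have hm0 := hmem.self_of_nhds
  by_cases hz : u 0 = 0
  · exact eventually_mul_le_binEntropy_sub_of_eq_zero hu hmem hz M
  · have h1 : u 0 = 1 := by
      by_contra h
      exact h0 ⟨lt_of_le_of_ne hm0.1 (Ne.symm hz), lt_of_le_of_ne hm0.2 h⟩
    have := eventually_mul_le_binEntropy_sub_of_eq_zero (u := fun t => 1 - u t)
      (by fun_prop) (hmem.mono fun t ht => ⟨by linarith [ht.2], by linarith [ht.1]⟩)
      (by simp [h1]) M
    filter_upwards [this] with t ht
    rw [Real.binEntropy_one_sub,
      show (1 - t) * (1 - u 0) + t / 2 = 1 - ((1 - t) * u 0 + t / 2) by ring,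
      Real.binEntropy_one_sub] at ht
    exact ht

lemma exists_eventually_neg_mul_le_binEntropy_sub {u : ℝ → ℝ} (hu : DifferentiableAt ℝ u 0)
    (hmem : ∀ᶠ t in 𝓝 0, u t ∈ Set.Icc (0 : ℝ) 1) :
    ∃ M : ℝ, 0 ≤ M ∧ ∀ᶠ t in 𝓝[>] (0 : ℝ), -(M * t) ≤
      Real.binEntropy ((1 - t) * u 0 + t / 2) - Real.binEntropy (u t) := by
  by_cases h0 : u 0 ∈ Set.Ioo (0 : ℝ) 1
  · have hH : DifferentiableAt ℝ Real.binEntropy (u 0) :=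
      (hasDerivAt_binEntropy h0).differentiableAt
    have hD : DifferentiableAt ℝ (fun t =>
        Real.binEntropy ((1 - t) * u 0 + t / 2) - Real.binEntropy (u t)) 0 := by
      refine DifferentiableAt.sub ?_ (hH.comp (0 : ℝ) hu)
      refine DifferentiableAt.comp (0 : ℝ) (g := Real.binEntropy) ?_ (by fun_prop)
      simpa using hH
    obtain ⟨C, hC⟩ := hD.isBigO_sub.bound
    refine ⟨|C|, abs_nonneg _, ?_⟩
    filter_upwards [nhdsWithin_le_nhds hC, self_mem_nhdsWithin] with t ht hpos
    have hpos : (0 : ℝ) < t := hpos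
    simp only [sub_zero, one_mul, zero_div, add_zero, sub_self, Real.norm_eq_abs,
      abs_of_pos hpos] at ht
    have := (abs_le.1 ht).1
    nlinarith [le_abs_self C]
  · refine ⟨0, le_rfl, ?_⟩
    filter_upwards [eventually_mul_le_binEntropy_sub hu hmem h0 0] with t ht
    simpa using ht

/-- The block areas move with the optimizer as well, but the entropy is bounded, so this contributes
only O(t) and cannot offset a superlinear gain. -/
lemma exists_eventually_neg_mul_le_weighted {w u : ℝ → ℝ} (hw : DifferentiableAt ℝ w 0)
    (hw0 : 0 < w 0) (hu : DifferentiableAt ℝ u 0)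
    (hmem : ∀ᶠ t in 𝓝 0, u t ∈ Set.Icc (0 : ℝ) 1) :
    (∃ M : ℝ, ∀ᶠ t in 𝓝[>] (0 : ℝ), -(M * t) ≤
      w 0 * Real.binEntropy ((1 - t) * u 0 + t / 2) - w t * Real.binEntropy (u t)) ∧
    (u 0 ∉ Set.Ioo (0 : ℝ) 1 → ∀ M : ℝ, ∀ᶠ t in 𝓝[>] (0 : ℝ), M * t ≤
      w 0 * Real.binEntropy ((1 - t) * u 0 + t / 2) - w t * Real.binEntropy (u t)) := by
  have hm0 := hmem.self_of_nhds
  obtain ⟨C, hC⟩ := hw.isBigO_sub.bound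
  have hC' : ∀ᶠ t in 𝓝[>] (0 : ℝ), -(|C| * t) ≤
      (w 0 - w t) * Real.binEntropy ((1 - t) * u 0 + t / 2) := by
    filter_upwards [nhdsWithin_le_nhds hC, self_mem_nhdsWithin,
      nhdsWithin_le_nhds (Iio_mem_nhds (show (0 : ℝ) < 1 by norm_num))] with t ht hpos ht1
    have hpos : (0 : ℝ) < t := hpos
    have ht1 : t < 1 := ht1
    have hφ := mix_mem (s := t) (e := 2⁻¹) ⟨hpos.le, ht1.le⟩ ⟨by norm_num, by norm_num⟩ hm0
    rw [← div_eq_mul_inv] at hφ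
    have h1 := Real.binEntropy_nonneg hφ.1 hφ.2
    have h2 : Real.binEntropy ((1 - t) * u 0 + t / 2) ≤ 1 :=
      Real.binEntropy_le_log_two.trans (by linarith [Real.log_two_lt_d9])
    simp only [sub_zero, Real.norm_eq_abs, abs_of_pos hpos] at ht
    have h3 : |w 0 - w t| ≤ |C| * t := by
      rw [abs_sub_comm]; exact ht.trans (mul_le_mul_of_nonneg_right (le_abs_self C) hpos.le)
    have h4 : |(w 0 - w t) * Real.binEntropy ((1 - t) * u 0 + t / 2)| ≤ |C| * t := by
      rw [abs_mul, abs_of_nonneg h1]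
      nlinarith [abs_nonneg (w 0 - w t)]
    exact (abs_le.1 h4).1
  have hwlo : ∀ᶠ t in 𝓝[>] (0 : ℝ), w 0 / 2 < w t :=
    nhdsWithin_le_nhds (hw.continuousAt.eventually (lt_mem_nhds (by linarith)))
  have hwhi : ∀ᶠ t in 𝓝[>] (0 : ℝ), w t < 2 * w 0 :=
    nhdsWithin_le_nhds (hw.continuousAt.eventually (gt_mem_nhds (by linarith)))
  refine ⟨?_, fun hext M => ?_⟩
  · obtain ⟨M, hM0, hM⟩ := exists_eventually_neg_mul_le_binEntropy_sub hu hmem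
    refine ⟨2 * w 0 * M + |C|, ?_⟩
    filter_upwards [hM, hC', hwlo, hwhi, self_mem_nhdsWithin] with t h1 h2 h3 h4 h5
    have h5 : (0 : ℝ) < t := h5
    have h6 := mul_le_mul_of_nonneg_left h1 (by linarith : 0 ≤ w t)
    have h7 := mul_le_mul_of_nonneg_right h4.le (by positivity : 0 ≤ M * t)
    linarith
  · have h0 := eventually_mul_le_binEntropy_sub hu hmem hext (2 * (|M| + |C|) / w 0)
    filter_upwards [h0, hC', hwlo, self_mem_nhdsWithin] with t h1 h2 h3 h5
    have h5 : (0 : ℝ) < t := h5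
    have h6 := mul_le_mul_of_nonneg_left h1 (by linarith : 0 ≤ w t)
    have h7 : (|M| + |C|) * t ≤ w t * (2 * (|M| + |C|) / w 0 * t) := by
      have := mul_le_mul_of_nonneg_right h3.le
        (by positivity : 0 ≤ 2 * (|M| + |C|) / w 0 * t)
      refine le_trans (le_of_eq ?_) this
      field_simp
    have h8 := mul_le_mul_of_nonneg_right (le_abs_self M) h5.le
    linarith

/-- A single value at 0 or 1 would contribute a superlinear gain, against which the other terms lose
at most a multiple of t. -/
lemma forall_mem_Ioo_of_eventually_sum_nonpos {ι : Type*} [Fintype ι] [DecidableEq ι]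
    {w u : ι → ℝ → ℝ} (hw : ∀ i, DifferentiableAt ℝ (w i) 0) (hw0 : ∀ i, 0 < w i 0)
    (hu : ∀ i, DifferentiableAt ℝ (u i) 0)
    (hmem : ∀ i, ∀ᶠ t in 𝓝 0, u i t ∈ Set.Icc (0 : ℝ) 1)
    (h : ∀ᶠ t in 𝓝[>] (0 : ℝ), ∑ i, (w i 0 * Real.binEntropy ((1 - t) * u i 0 + t / 2) -
      w i t * Real.binEntropy (u i t)) ≤ 0) (j : ι) : u j 0 ∈ Set.Ioo (0 : ℝ) 1 := by
  by_contra hj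
  choose M hM using fun i =>
    (exists_eventually_neg_mul_le_weighted (hw i) (hw0 i) (hu i) (hmem i)).1
  have hj' := (exists_eventually_neg_mul_le_weighted (hw j) (hw0 j) (hu j) (hmem j)).2 hj
    (∑ i ∈ Finset.univ.erase j, M i + 1)
  obtain ⟨t, h1, h2, h3, h4⟩ :=
    (h.and (hj'.and ((eventually_all.2 hM).and self_mem_nhdsWithin))).exists
  have h4 : (0 : ℝ) < t := h4
  rw [← Finset.add_sum_erase _ _ (Finset.mem_univ j)] at h1
  have h5 : ∑ i ∈ Finset.univ.erase j, -(M i * t) ≤ ∑ i ∈ Finset.univ.erase j,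
      (w i 0 * Real.binEntropy ((1 - t) * u i 0 + t / 2) - w i t * Real.binEntropy (u i t)) :=
    Finset.sum_le_sum fun i _ => h3 i
  rw [Finset.sum_neg_distrib, ← Finset.sum_mul] at h5
  linarith

/-! ### The Euler–Lagrange equations -/

/-- The parameters are those of a tripodal graphon with values in `(0,1)` that satisfies the
Euler–Lagrange equations with multipliers `α` and `β ≥ 0`. -/
structure IsCriticalTripodal (ap am b c d α β : ℝ) : Prop where
  ap_mem : ap ∈ Set.Ioo (0 : ℝ) 1
  am_mem : am ∈ Set.Ioo (0 : ℝ) 1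
  b_mem : b ∈ Set.Ioo (0 : ℝ) 1
  d_mem : d ∈ Set.Ioo (0 : ℝ) 1
  nonneg : 0 ≤ β
  slope_ap : entropySlope ap = 2 * α + 6 * β * (c * (am * ap) + (1 - c) * d ^ 2)
  slope_am : entropySlope am = 2 * α + 6 * β * (c * ((am ^ 2 + ap ^ 2) / 2) + (1 - c) * d ^ 2)
  slope_b : entropySlope b = 2 * α + 6 * β * (c * d ^ 2 + (1 - c) * b ^ 2)
  slope_d : entropySlope d = 2 * α + 6 * β * (c * d * ((am + ap) / 2) + (1 - c) * d * b)
  size : c / 2 * (Real.binEntropy am + Real.binEntropy ap) + (1 - 2 * c) * Real.binEntropy d -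
      (1 - c) * Real.binEntropy b =
    α * (c * (am + ap) + 2 * (1 - 2 * c) * d - 2 * (1 - c) * b) +
    β * (3 * c ^ 2 / 8 * ((am + ap) ^ 3 + (am - ap) ^ 3) +
      3 / 2 * (2 * c - 3 * c ^ 2) * d ^ 2 * (am + ap) +
      3 * (1 - c) * (1 - 3 * c) * b * d ^ 2 - 3 * (1 - c) ^ 2 * b ^ 3)

lemma nonneg_of_hasDerivAt_of_eventually_le {f : ℝ → ℝ} {f' : ℝ} (hf : HasDerivAt f f' 0)
    (h : ∀ᶠ t in 𝓝[>] (0 : ℝ), f 0 ≤ f t) : 0 ≤ f' := by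
  have h1 := hasDerivAt_iff_tendsto_slope.1 hf
  have h2 : Tendsto (slope f 0) (𝓝[>] 0) (𝓝 f') :=
    h1.mono_left (nhdsWithin_mono _ fun x hx => ne_of_gt hx)
  refine ge_of_tendsto h2 ?_
  filter_upwards [h, self_mem_nhdsWithin] with t ht hpos
  have hpos : (0 : ℝ) < t := hpos
  rw [slope_def_field]
  exact div_nonneg (by linarith) (by linarith)

section

variable {ap am b c d : ℝ × ℝ → ℝ} {p : ℝ × ℝ}

/-- Along a differentiable family of optimal tripodal graphons the values lie in `(0,1)`. -/
lemma mem_Ioo_of_eventually_isUniqueOptimizer (hap : DifferentiableAt ℝ ap p)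
    (ham : DifferentiableAt ℝ am p) (hb : DifferentiableAt ℝ b p) (hc : DifferentiableAt ℝ c p)
    (hd : DifferentiableAt ℝ d p)
    (h : ∀ᶠ q in 𝓝 p, IsB21orC12 (ap q) (am q) (b q) (c q) (d q) ∧
      IsUniqueOptimizer q (tripodal (ap q) (am q) (b q) (c q) (d q))) :
    ap p ∈ Set.Ioo (0 : ℝ) 1 ∧ am p ∈ Set.Ioo (0 : ℝ) 1 ∧ b p ∈ Set.Ioo (0 : ℝ) 1 ∧
      d p ∈ Set.Ioo (0 : ℝ) 1 := by
  obtain ⟨h0, hopt⟩ := h.self_of_nhds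
  have hc0 := Set.Ioo_subset_Icc_self h0.c_mem
  -- The trial graphon mixes the optimizer at `p` with the constant 1/2. Its densities `q t` move,
  -- so it is compared with the optimizer at `q t`, which varies differentiably.
  let m : ℝ → ℝ → ℝ := fun u t => (1 - t) * u + t / 2
  let q : ℝ → ℝ × ℝ := fun t =>
    (triEdge (m (ap p) t) (m (am p) t) (m (b p) t) (c p) (m (d p) t),
      triTriangle (m (ap p) t) (m (am p) t) (m (b p) t) (c p) (m (d p) t))
  have hq0 : q 0 = p := by
    have h1 := hopt.1.edge
    have h2 := hopt.1.triangle
    rw [edgeDensity_tripodal hc0] at h1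
    rw [triangleDensity_tripodal hc0] at h2
    ext <;> simp [q, m, h1, h2]
  have hq : DifferentiableAt ℝ q 0 := by
    simp only [q, m, triEdge, triTriangle]
    fun_prop
  have hcomp : ∀ {f : ℝ × ℝ → ℝ}, DifferentiableAt ℝ f p → DifferentiableAt ℝ (fun t => f (q t)) 0 :=
    fun hf => DifferentiableAt.comp (0 : ℝ) (by rwa [hq0]) hq
  have hq_tendsto : Tendsto q (𝓝 0) (𝓝 p) := hq0 ▸ hq.continuousAt.tendsto
  have hev := hq_tendsto.eventually h
  let u : Fin 4 → ℝ → ℝ := ![fun t => ap (q t), fun t => am (q t), fun t => b (q t),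
    fun t => d (q t)]
  let w : Fin 4 → ℝ → ℝ := ![fun t => c (q t) ^ 2 / 4, fun t => c (q t) ^ 2 / 4,
    fun t => (1 - c (q t)) ^ 2 / 2, fun t => c (q t) * (1 - c (q t))]
  have hcq := hcomp hc
  have h1 : 0 < c p := h0.c_mem.1
  have h2 : 0 < 1 - c p := by linarith [h0.c_mem.2]
  have key := forall_mem_Ioo_of_eventually_sum_nonpos (w := w) (u := u)
    (by
      intro i
      fin_cases i
      exacts [(hcq.pow 2).div_const 4, (hcq.pow 2).div_const 4,
        ((hcq.const_sub 1).pow 2).div_const 2, hcq.mul (hcq.const_sub 1)])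
    (by intro i; fin_cases i <;> simp [w, hq0] <;> nlinarith [h1, h2, mul_pos h1 h2])
    (by
      intro i
      fin_cases i
      exacts [hcomp hap, hcomp ham, hcomp hb, hcomp hd])
    (by
      intro i
      filter_upwards [hev] with t ht
      fin_cases i
      exacts [ht.1.ap_mem, ht.1.am_mem, ht.1.b_mem, ht.1.d_mem])
    (by
      filter_upwards [nhdsWithin_le_nhds hev, self_mem_nhdsWithin,
        nhdsWithin_le_nhds (Iio_mem_nhds (show (0 : ℝ) < 1 by norm_num))] with t ht hpos ht1
      have hs : t ∈ Set.Icc (0 : ℝ) 1 := ⟨le_of_lt hpos, le_of_lt ht1⟩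
      have hmem : ∀ {v : ℝ}, v ∈ Set.Icc (0 : ℝ) 1 → m v t ∈ Set.Icc (0 : ℝ) 1 := fun hv => by
        have := mix_mem (e := 2⁻¹) hs ⟨by norm_num, by norm_num⟩ hv
        rwa [← div_eq_mul_inv] at this
      have hmax := ht.2.1.maximal
        (tripodal (m (ap p) t) (m (am p) t) (m (b p) t) (c p) (m (d p) t))
        (isGraphon_tripodal (hmem h0.ap_mem) (hmem h0.am_mem) (hmem h0.b_mem) (hmem h0.d_mem))
        (edgeDensity_tripodal hc0 ..) (triangleDensity_tripodal hc0 ..)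
      rw [entropy_tripodal hc0, entropy_tripodal (Set.Ioo_subset_Icc_self ht.1.c_mem)] at hmax
      simp only [triEntropy, m] at hmax
      simp [Fin.sum_univ_four, w, u, hq0]
      linarith)
  have e : ∀ f : ℝ × ℝ → ℝ, f (q 0) = f p := fun f => by rw [hq0]
  exact ⟨e ap ▸ key 0, e am ▸ key 1, e b ▸ key 2, e d ▸ key 3⟩

/-- The maximal entropy in a phase is differentiable, and its gradient provides the Lagrange
multipliers. -/
lemma derivative_eq_of_eventually_isUniqueOptimizer
    (h : ∀ᶠ q in 𝓝 p, IsB21orC12 (ap q) (am q) (b q) (c q) (d q) ∧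
      IsUniqueOptimizer q (tripodal (ap q) (am q) (b q) (c q) (d q)))
    {E : ℝ × ℝ →L[ℝ] ℝ}
    (hE : HasFDerivAt (fun q => triEntropy (ap q) (am q) (b q) (c q) (d q)) E p)
    {x₁ x₂ x₃ x₄ x₅ : ℝ → ℝ} (h₁ : x₁ 0 = ap p) (h₂ : x₂ 0 = am p) (h₃ : x₃ 0 = b p)
    (h₄ : x₄ 0 = c p) (h₅ : x₅ 0 = d p)
    (hx : ∀ᶠ t in 𝓝 0, x₁ t ∈ Set.Icc (0 : ℝ) 1 ∧ x₂ t ∈ Set.Icc (0 : ℝ) 1 ∧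
      x₃ t ∈ Set.Icc (0 : ℝ) 1 ∧ x₄ t ∈ Set.Icc (0 : ℝ) 1 ∧ x₅ t ∈ Set.Icc (0 : ℝ) 1)
    {e' t' s' : ℝ} (he : HasDerivAt (fun t => triEdge (x₁ t) (x₂ t) (x₃ t) (x₄ t) (x₅ t)) e' 0)
    (ht : HasDerivAt (fun t => triTriangle (x₁ t) (x₂ t) (x₃ t) (x₄ t) (x₅ t)) t' 0)
    (hs : HasDerivAt (fun t => triEntropy (x₁ t) (x₂ t) (x₃ t) (x₄ t) (x₅ t)) s' 0) :
    s' = E (1, 0) * e' + E (0, 1) * t' := by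
  obtain ⟨h0, hopt⟩ := h.self_of_nhds
  have hc0 := Set.Ioo_subset_Icc_self h0.c_mem
  let q : ℝ → ℝ × ℝ := fun t => (triEdge (x₁ t) (x₂ t) (x₃ t) (x₄ t) (x₅ t),
    triTriangle (x₁ t) (x₂ t) (x₃ t) (x₄ t) (x₅ t))
  have hq0 : q 0 = p := by
    have h1 := hopt.1.edge
    have h2 := hopt.1.triangle
    rw [edgeDensity_tripodal hc0] at h1
    rw [triangleDensity_tripodal hc0] at h2
    ext <;> simp [q, h₁, h₂, h₃, h₄, h₅, h1, h2]
  have hq : HasDerivAt q (e', t') 0 := he.prodMk ht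
  have hq_tendsto : Tendsto q (𝓝 0) (𝓝 p) := hq0 ▸ hq.continuousAt.tendsto
  have hEq := HasFDerivAt.comp_hasDerivAt (0 : ℝ) (by rw [hq0]; exact hE) hq
  -- Envelope argument: the family is optimal at the densities of the trial graphon and equals it at
  -- time 0. No constraint qualification is needed.
  have hmin : IsLocalMin (fun t => triEntropy (ap (q t)) (am (q t)) (b (q t)) (c (q t)) (d (q t)) -
      triEntropy (x₁ t) (x₂ t) (x₃ t) (x₄ t) (x₅ t)) 0 := by
    filter_upwards [hq_tendsto.eventually h, hx] with t ht hxt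
    obtain ⟨k1, k2, k3, k4, k5⟩ := hxt
    have hmax := ht.2.1.maximal (tripodal (x₁ t) (x₂ t) (x₃ t) (x₄ t) (x₅ t))
      (isGraphon_tripodal k1 k2 k3 k5) (edgeDensity_tripodal k4 ..)
      (triangleDensity_tripodal k4 ..)
    rw [entropy_tripodal k4, entropy_tripodal (Set.Ioo_subset_Icc_self ht.1.c_mem)] at hmax
    rw [hq0, h₁, h₂, h₃, h₄, h₅, sub_self]
    linarith
  have := hmin.hasDerivAt_eq_zero (hEq.sub hs)
  have hlin : E (e', t') = E (1, 0) * e' + E (0, 1) * t' := by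
    have : ((e', t') : ℝ × ℝ) = e' • (1, 0) + t' • (0, 1) := by simp
    rw [this, map_add, map_smul, map_smul, smul_eq_mul, smul_eq_mul]
    ring
  linarith

end

/-! ### Derivatives of the densities and the entropy along a path of parameters -/

section

variable {ap am b c d : ℝ → ℝ} {ap' am' b' c' d' t : ℝ}

lemma hasDerivAt_triEdge (h₁ : HasDerivAt ap ap' t) (h₂ : HasDerivAt am am' t)
    (h₃ : HasDerivAt b b' t) (h₄ : HasDerivAt c c' t) (h₅ : HasDerivAt d d' t) :
    HasDerivAt (fun t => triEdge (ap t) (am t) (b t) (c t) (d t))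
      (c t ^ 2 / 2 * (am' + ap') + 2 * c t * (1 - c t) * d' + (1 - c t) ^ 2 * b' +
        (c t * (am t + ap t) + 2 * (1 - 2 * c t) * d t - 2 * (1 - c t) * b t) * c') t := by
  have hk := h₄.const_sub 1
  have := ((((h₄.pow 2).div_const 2).mul (h₂.add h₁)).add
    (((h₄.const_mul 2).mul hk).mul h₅)).add ((hk.pow 2).mul h₃)
  refine HasDerivAt.congr_deriv (f := fun t => triEdge (ap t) (am t) (b t) (c t) (d t)) this ?_
  simp
  ring

lemma hasDerivAt_triTriangle (h₁ : HasDerivAt ap ap' t) (h₂ : HasDerivAt am am' t)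
    (h₃ : HasDerivAt b b' t) (h₄ : HasDerivAt c c' t) (h₅ : HasDerivAt d d' t) :
    HasDerivAt (fun t => triTriangle (ap t) (am t) (b t) (c t) (d t))
      (3 * (c t ^ 2 / 2 * (c t * ((am t ^ 2 + ap t ^ 2) / 2) + (1 - c t) * d t ^ 2) * am' +
        c t ^ 2 / 2 * (c t * (am t * ap t) + (1 - c t) * d t ^ 2) * ap' +
        2 * c t * (1 - c t) * (c t * d t * ((am t + ap t) / 2) + (1 - c t) * d t * b t) * d' +
        (1 - c t) ^ 2 * (c t * d t ^ 2 + (1 - c t) * b t ^ 2) * b') +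
        (3 * c t ^ 2 / 8 * ((am t + ap t) ^ 3 + (am t - ap t) ^ 3) +
          3 / 2 * (2 * c t - 3 * c t ^ 2) * d t ^ 2 * (am t + ap t) +
          3 * (1 - c t) * (1 - 3 * c t) * b t * d t ^ 2 - 3 * (1 - c t) ^ 2 * b t ^ 3) * c') t := by
  have hk := h₄.const_sub 1
  have := (((((h₄.pow 3).div_const 8).mul (((h₂.add h₁).pow 3).add ((h₂.sub h₁).pow 3))).add
    ((((hk.const_mul (3 / 2)).mul (h₄.pow 2)).mul (h₅.pow 2)).mul (h₂.add h₁))).add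
    (((((hk.pow 2).const_mul 3).mul h₄).mul h₃).mul (h₅.pow 2))).add
    ((hk.pow 3).mul (h₃.pow 3))
  refine HasDerivAt.congr_deriv
    (f := fun t => triTriangle (ap t) (am t) (b t) (c t) (d t)) this ?_
  simp
  ring

/-- Differentiability is required of the entropies of the values rather than of the values: this
admits values that stay fixed at 0 or 1, where the binary entropy has no derivative. -/
lemma hasDerivAt_triEntropy_of_hasDerivAt {H₁' H₂' H₃' H₅' : ℝ}
    (h₁ : HasDerivAt (fun t => Real.binEntropy (ap t)) H₁' t)
    (h₂ : HasDerivAt (fun t => Real.binEntropy (am t)) H₂' t)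
    (h₃ : HasDerivAt (fun t => Real.binEntropy (b t)) H₃' t) (h₄ : HasDerivAt c c' t)
    (h₅ : HasDerivAt (fun t => Real.binEntropy (d t)) H₅' t) :
    HasDerivAt (fun t => triEntropy (ap t) (am t) (b t) (c t) (d t))
      (c t ^ 2 / 4 * (H₂' + H₁') + c t * (1 - c t) * H₅' + (1 - c t) ^ 2 / 2 * H₃' +
        (c t / 2 * (Real.binEntropy (am t) + Real.binEntropy (ap t)) +
          (1 - 2 * c t) * Real.binEntropy (d t) - (1 - c t) * Real.binEntropy (b t)) * c') t := by
  have hk := h₄.const_sub 1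
  have := ((((h₄.pow 2).div_const 4).mul (h₂.add h₁)).add
    ((h₄.mul hk).mul h₅)).add (((hk.pow 2).div_const 2).mul h₃)
  refine HasDerivAt.congr_deriv
    (f := fun t => triEntropy (ap t) (am t) (b t) (c t) (d t)) this ?_
  simp
  ring

lemma hasDerivAt_triEntropy (h₁ : HasDerivAt ap ap' t) (h₂ : HasDerivAt am am' t)
    (h₃ : HasDerivAt b b' t) (h₄ : HasDerivAt c c' t) (h₅ : HasDerivAt d d' t)
    (m₁ : ap t ∈ Set.Ioo (0 : ℝ) 1) (m₂ : am t ∈ Set.Ioo (0 : ℝ) 1)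
    (m₃ : b t ∈ Set.Ioo (0 : ℝ) 1) (m₅ : d t ∈ Set.Ioo (0 : ℝ) 1) :
    HasDerivAt (fun t => triEntropy (ap t) (am t) (b t) (c t) (d t))
      (c t ^ 2 / 4 * (entropySlope (am t) * am' + entropySlope (ap t) * ap') +
        c t * (1 - c t) * (entropySlope (d t) * d') +
        (1 - c t) ^ 2 / 2 * (entropySlope (b t) * b') +
        (c t / 2 * (Real.binEntropy (am t) + Real.binEntropy (ap t)) +
          (1 - 2 * c t) * Real.binEntropy (d t) - (1 - c t) * Real.binEntropy (b t)) * c') t :=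
  hasDerivAt_triEntropy_of_hasDerivAt ((hasDerivAt_binEntropy m₁).comp t h₁)
    ((hasDerivAt_binEntropy m₂).comp t h₂) ((hasDerivAt_binEntropy m₃).comp t h₃) h₄
    ((hasDerivAt_binEntropy m₅).comp t h₅)

end

/-- The multipliers are the partial derivatives of the maximal entropy with respect to ε and τ. -/
lemma IsB21orC12Phase.exists_isCriticalTripodal {V : Set (ℝ × ℝ)} (hV : IsB21orC12Phase V)
    {p : ℝ × ℝ} (hp : p ∈ V) :
    ∃ ap am b c d α β : ℝ, IsB21orC12 ap am b c d ∧
      IsUniqueOptimizer p (tripodal ap am b c d) ∧ IsCriticalTripodal ap am b c d α β := by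
  obtain ⟨ap, am, b, c, d, hap, ham, hb, hc, hd, h⟩ := hV.optimal p hp
  obtain ⟨h0, hopt⟩ := h.self_of_nhds
  obtain ⟨m₁, m₂, m₃, m₅⟩ := mem_Ioo_of_eventually_isUniqueOptimizer hap.differentiableAt
    ham.differentiableAt hb.differentiableAt hc.differentiableAt hd.differentiableAt h
  have m₄ := h0.c_mem
  have hc0 := Set.Ioo_subset_Icc_self m₄
  have hH : ∀ {f : ℝ × ℝ → ℝ}, AnalyticAt ℝ f p → f p ∈ Set.Ioo (0 : ℝ) 1 →
      DifferentiableAt ℝ (fun q => Real.binEntropy (f q)) p := fun hf hm =>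
    DifferentiableAt.comp p (hasDerivAt_binEntropy hm).differentiableAt hf.differentiableAt
  have d₁ := hH hap m₁
  have d₂ := hH ham m₂
  have d₃ := hH hb m₃
  have d₅ := hH hd m₅
  have d₄ := hc.differentiableAt
  have w₁ : DifferentiableAt ℝ (fun q => c q ^ 2 / 4) p := by fun_prop
  have w₂ : DifferentiableAt ℝ (fun q => c q * (1 - c q)) p := by fun_prop
  have w₃ : DifferentiableAt ℝ (fun q => (1 - c q) ^ 2 / 2) p := by fun_prop
  have hE : DifferentiableAt ℝ (fun q => triEntropy (ap q) (am q) (b q) (c q) (d q)) p :=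
    ((w₁.mul (d₂.add d₁)).add (w₂.mul d₅)).add (w₃.mul d₃)
  set E := fderiv ℝ (fun q => triEntropy (ap q) (am q) (b q) (c q) (d q)) p with hEdef
  have key := @derivative_eq_of_eventually_isUniqueOptimizer ap am b c d p h E hE.hasFDerivAt
  have shift : ∀ {v : ℝ}, HasDerivAt (fun t : ℝ => v + t) 1 0 := fun {v} =>
    (hasDerivAt_id (0 : ℝ)).const_add v
  have fixed : ∀ {v : ℝ}, HasDerivAt (fun _ : ℝ => v) 0 0 := fun {v} => hasDerivAt_const _ _
  have icc : ∀ {v : ℝ}, v ∈ Set.Ioo (0 : ℝ) 1 → ∀ᶠ _ : ℝ in 𝓝 0, v ∈ Set.Icc (0 : ℝ) 1 :=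
    fun hv => Eventually.of_forall fun _ => Set.Ioo_subset_Icc_self hv
  have icc' : ∀ {v : ℝ}, v ∈ Set.Ioo (0 : ℝ) 1 → ∀ᶠ t : ℝ in 𝓝 0, v + t ∈ Set.Icc (0 : ℝ) 1 := by
    intro v hv
    have : Tendsto (fun t : ℝ => v + t) (𝓝 0) (𝓝 v) :=
      Continuous.tendsto' (by fun_prop) _ _ (by simp)
    exact (this.eventually (isOpen_Ioo.mem_nhds hv)).mono fun t ht => Set.Ioo_subset_Icc_self ht
  have z : ∀ {v : ℝ}, v ∈ Set.Ioo (0 : ℝ) 1 → v + 0 ∈ Set.Ioo (0 : ℝ) 1 := fun hv => by simpa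
  -- Moving one of the five parameters at a time gives one Euler–Lagrange equation each.
  have kap := key (x₁ := fun t => ap p + t) (x₂ := fun _ => am p) (x₃ := fun _ => b p)
    (x₄ := fun _ => c p) (x₅ := fun _ => d p) (by simp) rfl rfl rfl rfl
    ((icc' m₁).and ((icc m₂).and ((icc m₃).and ((icc m₄).and (icc m₅)))))
    (hasDerivAt_triEdge shift fixed fixed fixed fixed)
    (hasDerivAt_triTriangle shift fixed fixed fixed fixed)
    (hasDerivAt_triEntropy shift fixed fixed fixed fixed (z m₁) m₂ m₃ m₅)
  have kam := key (x₁ := fun t => ap p) (x₂ := fun t => am p + t) (x₃ := fun _ => b p)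
    (x₄ := fun _ => c p) (x₅ := fun _ => d p) rfl (by simp) rfl rfl rfl
    ((icc m₁).and ((icc' m₂).and ((icc m₃).and ((icc m₄).and (icc m₅)))))
    (hasDerivAt_triEdge fixed shift fixed fixed fixed)
    (hasDerivAt_triTriangle fixed shift fixed fixed fixed)
    (hasDerivAt_triEntropy fixed shift fixed fixed fixed m₁ (z m₂) m₃ m₅)
  have kb := key (x₁ := fun t => ap p) (x₂ := fun _ => am p) (x₃ := fun t => b p + t)
    (x₄ := fun _ => c p) (x₅ := fun _ => d p) rfl rfl (by simp) rfl rfl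
    ((icc m₁).and ((icc m₂).and ((icc' m₃).and ((icc m₄).and (icc m₅)))))
    (hasDerivAt_triEdge fixed fixed shift fixed fixed)
    (hasDerivAt_triTriangle fixed fixed shift fixed fixed)
    (hasDerivAt_triEntropy fixed fixed shift fixed fixed m₁ m₂ (z m₃) m₅)
  have kc := key (x₁ := fun t => ap p) (x₂ := fun _ => am p) (x₃ := fun _ => b p)
    (x₄ := fun t => c p + t) (x₅ := fun _ => d p) rfl rfl rfl (by simp) rfl
    ((icc m₁).and ((icc m₂).and ((icc m₃).and ((icc' m₄).and (icc m₅)))))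
    (hasDerivAt_triEdge fixed fixed fixed shift fixed)
    (hasDerivAt_triTriangle fixed fixed fixed shift fixed)
    (hasDerivAt_triEntropy fixed fixed fixed shift fixed m₁ m₂ m₃ m₅)
  have kd := key (x₁ := fun t => ap p) (x₂ := fun _ => am p) (x₃ := fun _ => b p)
    (x₄ := fun _ => c p) (x₅ := fun t => d p + t) rfl rfl rfl rfl (by simp)
    ((icc m₁).and ((icc m₂).and ((icc m₃).and ((icc m₄).and (icc' m₅)))))
    (hasDerivAt_triEdge fixed fixed fixed fixed shift)
    (hasDerivAt_triTriangle fixed fixed fixed fixed shift)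
    (hasDerivAt_triEntropy fixed fixed fixed fixed shift m₁ m₂ m₃ (z m₅))
  simp only [add_zero, mul_one, mul_zero, zero_add] at kap kam kb kc kd
  -- Raising τ at fixed ε cannot lower the maximal entropy below the Erdős–Rényi curve: the old
  -- optimizer has fewer triangles than allowed.
  have hβ : 0 ≤ E (0, 1) := by
    have hline : HasDerivAt (fun u : ℝ => p + u • ((0, 1) : ℝ × ℝ)) (0, 1) 0 := by
      simpa using ((hasDerivAt_id (0 : ℝ)).smul_const ((0, 1) : ℝ × ℝ)).const_add p
    have hd := HasFDerivAt.comp_hasDerivAt (0 : ℝ)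
      (by simpa using hE.hasFDerivAt) hline
    refine nonneg_of_hasDerivAt_of_eventually_le hd ?_
    have ht : Tendsto (fun u : ℝ => p + u • ((0, 1) : ℝ × ℝ)) (𝓝 0) (𝓝 p) :=
      Continuous.tendsto' (by fun_prop) _ _ (by simp)
    filter_upwards [nhdsWithin_le_nhds (ht.eventually h),
      nhdsWithin_le_nhds (ht.eventually (hV.isOpen.mem_nhds hp)), self_mem_nhdsWithin]
      with u hu huV hpos
    have hpos : (0 : ℝ) < u := hpos
    have he := hopt.1.edge
    have ht := hopt.1.triangle
    rw [edgeDensity_tripodal hc0] at he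
    rw [triangleDensity_tripodal hc0] at ht
    have := hu.2.1.triEntropy_le_entropy (hV.below _ huV).le h0.ap_mem h0.am_mem h0.b_mem hc0
      h0.d_mem (by simpa using he) (by simp [ht, hpos.le])
    rw [entropy_tripodal (Set.Ioo_subset_Icc_self hu.1.c_mem)] at this
    have h00 : p + ((0, 0) : ℝ × ℝ) = p := by ext <;> simp
    simpa [h00] using this
  have c0 : 0 < c p := m₄.1
  have k0 : 0 < 1 - c p := by linarith [m₄.2]
  refine ⟨ap p, am p, b p, c p, d p, E (1, 0), E (0, 1), h0, hopt, m₁, m₂, m₃, m₅, hβ,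
    ?_, ?_, ?_, ?_, by linarith⟩
  · have : c p ^ 2 / 4 ≠ 0 := by positivity
    apply mul_left_cancel₀ this
    linarith
  · have : c p ^ 2 / 4 ≠ 0 := by positivity
    apply mul_left_cancel₀ this
    linarith
  · have : (1 - c p) ^ 2 / 2 ≠ 0 := by positivity
    apply mul_left_cancel₀ this
    linarith
  · have : c p * (1 - c p) ≠ 0 := by positivity
    apply mul_left_cancel₀ this
    linarith

/-! ### Cut distance to a bipodal graphon -/

lemma abs_setIntegral_sub_le_labelledCutDist {f g : I → I → ℝ}
    (hf : ∀ x y, f x y ∈ Set.Icc (0 : ℝ) 1) (hg : ∀ x y, g x y ∈ Set.Icc (0 : ℝ) 1)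
    {S T : Set I} (hS : MeasurableSet S) (hT : MeasurableSet T) :
    |∫ x in S, ∫ y in T, (f x y - g x y)| ≤ labelledCutDist f g := by
  refine le_csSup ⟨1, ?_⟩ ⟨S, T, hS, hT, rfl⟩
  rintro r ⟨S, T, -, -, rfl⟩
  have h1 : ∀ x, ‖∫ y in T, (f x y - g x y)‖ ≤ 1 := by
    intro x
    refine (norm_setIntegral_le_of_norm_le_const (C := 1) (measure_lt_top _ _) ?_).trans ?_
    · intro y _
      rw [Real.norm_eq_abs, abs_le]
      constructor <;> linarith [(hf x y).1, (hf x y).2, (hg x y).1, (hg x y).2]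
    · simp
  refine (norm_setIntegral_le_of_norm_le_const (C := 1) (measure_lt_top _ _)
    fun x _ => h1 x).trans ?_
  simp

lemma exists_labelledCutDist_lt_of_cutDist_lt {f g : I → I → ℝ} {r : ℝ} (h : cutDist f g < r) :
    ∃ φ : I ≃ᵐ I, MeasurePreserving φ volume volume ∧
      labelledCutDist f (fun x y => g (φ x) (φ y)) < r := by
  have : Nonempty {φ : I ≃ᵐ I // MeasurePreserving φ volume volume} :=
    ⟨⟨MeasurableEquiv.refl I, MeasurePreserving.id _⟩⟩
  obtain ⟨φ, hφ⟩ := exists_lt_of_ciInf_lt h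
  exact ⟨φ.1, φ.2, hφ⟩

lemma setIntegral_setIntegral_sub_const {g : I → I → ℝ} (hg : IsGraphon g) {S T : Set I}
    (C : ℝ) :
    ∫ x in S, ∫ y in T, (g x y - C) =
      (∫ x in S, ∫ y in T, g x y) - C * volume.real S * volume.real T := by
  have hbound : ∀ x y, ‖g x y‖ ≤ 1 := fun x y => by
    rw [Real.norm_eq_abs, abs_of_nonneg (hg.mem_Icc x y).1]; exact (hg.mem_Icc x y).2
  have h1 : ∀ x, ∫ y in T, (g x y - C) = (∫ y in T, g x y) - C * volume.real T := by
    intro x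
    have hm : Measurable (g x) := hg.measurable.comp measurable_prodMk_left
    rw [integral_sub (Integrable.of_bound hm.aestronglyMeasurable 1 (ae_of_all _ (hbound x)))
      (integrable_const C)]
    simp [mul_comm]
  simp only [h1]
  have h2 : StronglyMeasurable (fun x => ∫ y in T, g x y) :=
    hg.measurable.stronglyMeasurable.integral_prod_right
  rw [integral_sub (Integrable.of_bound h2.aestronglyMeasurable 1 (ae_of_all _ fun x => ?_))
    (integrable_const _)]
  · simp; ring
  · refine (norm_setIntegral_le_of_norm_le_const (C := 1) (measure_lt_top _ _)
      fun y _ => hbound x y).trans ?_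
    simp

/-- Two step graphons that are close to the same graphon in the cut metric have podes with
compatible overlaps. -/
lemma exists_overlap {g : I → I → ℝ} (hg : IsGraphon g) {ap am b c d a₀ b₀ c₀ d₀ r₁ r₂ : ℝ}
    (h : IsB21orC12 ap am b c d) (h₀ : IsB11 a₀ b₀ c₀ d₀)
    (h₁ : cutDist g (tripodal ap am b c d) < r₁) (h₂ : cutDist g (bipodal a₀ b₀ c₀ d₀) < r₂) :
    ∃ x : Fin 3 → Fin 2 → ℝ, (∀ i j, x i j ∈ Set.Icc (0 : ℝ) 1) ∧
      (∀ i, ∑ j, x i j = podeSize c i) ∧ (∀ j, ∑ i, x i j = bipodeSize c₀ j) ∧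
      ∀ i j k l, |podeValue ap am b d i k - bipodeValue a₀ b₀ d₀ j l| * x i j * x k l ≤
        r₁ + r₂ := by
  obtain ⟨φ, hφ, hφr⟩ := exists_labelledCutDist_lt_of_cutDist_lt h₁
  obtain ⟨ψ, hψ, hψr⟩ := exists_labelledCutDist_lt_of_cutDist_lt h₂
  let F : I → Fin 3 := fun s => podeIndex c (φ s)
  let G : I → Fin 2 := fun s => bipodeIndex c₀ (ψ s)
  have hF : Measurable F := (measurable_podeIndex c).comp φ.measurable
  have hG : Measurable G := (measurable_bipodeIndex c₀).comp ψ.measurable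
  have hFi : ∀ i, MeasurableSet (F ⁻¹' {i}) := fun i => hF (MeasurableSet.singleton i)
  have hGj : ∀ j, MeasurableSet (G ⁻¹' {j}) := fun j => hG (MeasurableSet.singleton j)
  -- Both rearranged step graphons are constant on products of these sets, so testing the cut norm
  -- on such a product compares two values, weighted by the overlaps.
  let S : Fin 3 → Fin 2 → Set I := fun i j => F ⁻¹' {i} ∩ G ⁻¹' {j}
  have hS : ∀ i j, MeasurableSet (S i j) := fun i j => (hFi i).inter (hGj j)
  refine ⟨fun i j => volume.real (S i j), fun i j => ⟨measureReal_nonneg, measureReal_le_one⟩,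
    fun i => ?_, fun j => ?_, fun i j k l => ?_⟩
  · have h1 := sum_measureReal_preimage_singleton (μ := volume.restrict (F ⁻¹' {i})) (f := G)
      Finset.univ (fun j _ => hGj j)
    simp only [measureReal_restrict_apply (hGj _)] at h1
    simp only [S]
    simp_rw [Set.inter_comm (F ⁻¹' {i})]
    rw [h1]
    simp only [Finset.coe_univ, Set.preimage_univ, measureReal_restrict_apply MeasurableSet.univ,
      Set.univ_inter]
    have h2 : F ⁻¹' {i} = φ ⁻¹' (podeIndex c ⁻¹' {i}) := rfl
    rw [h2, hφ.measureReal_preimage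
      ((measurable_podeIndex c) (MeasurableSet.singleton i)).nullMeasurableSet,
      real_volume_podeIndex (Set.Ioo_subset_Icc_self h.c_mem)]
  · have h1 := sum_measureReal_preimage_singleton (μ := volume.restrict (G ⁻¹' {j})) (f := F)
      Finset.univ (fun i _ => hFi i)
    simp only [measureReal_restrict_apply (hFi _)] at h1
    simp only [S]
    rw [h1]
    simp only [Finset.coe_univ, Set.preimage_univ, measureReal_restrict_apply MeasurableSet.univ,
      Set.univ_inter]
    have h2 : G ⁻¹' {j} = ψ ⁻¹' (bipodeIndex c₀ ⁻¹' {j}) := rfl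
    rw [h2, hψ.measureReal_preimage
      ((measurable_bipodeIndex c₀) (MeasurableSet.singleton j)).nullMeasurableSet,
      real_volume_bipodeIndex (Set.Ioo_subset_Icc_self h₀.c_mem)]
  · have hT := (isGraphon_tripodal h.ap_mem h.am_mem h.b_mem h.d_mem (c := c)).mem_Icc
    have hB : ∀ x y, bipodal a₀ b₀ c₀ d₀ x y ∈ Set.Icc (0 : ℝ) 1 := by
      intro x y
      unfold bipodal
      split_ifs
      exacts [h₀.a_mem, h₀.d_mem, h₀.d_mem, h₀.b_mem]
    have e1 := (abs_setIntegral_sub_le_labelledCutDist hg.mem_Icc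
      (fun x y => hT (φ x) (φ y)) (hS i j) (hS k l)).trans hφr.le
    have e2 := (abs_setIntegral_sub_le_labelledCutDist hg.mem_Icc
      (fun x y => hB (ψ x) (ψ y)) (hS i j) (hS k l)).trans hψr.le
    have f1 : ∫ x in S i j, ∫ y in S k l, (g x y - tripodal ap am b c d (φ x) (φ y)) =
        ∫ x in S i j, ∫ y in S k l, (g x y - podeValue ap am b d i k) := by
      refine setIntegral_congr_fun (hS i j) fun x hx => setIntegral_congr_fun (hS k l) fun y hy => ?_
      have hx' : podeIndex c (φ x) = i := hx.1
      have hy' : podeIndex c (φ y) = k := hy.1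
      simp only [tripodal_eq, hx', hy']
    have f2 : ∫ x in S i j, ∫ y in S k l, (g x y - bipodal a₀ b₀ c₀ d₀ (ψ x) (ψ y)) =
        ∫ x in S i j, ∫ y in S k l, (g x y - bipodeValue a₀ b₀ d₀ j l) := by
      refine setIntegral_congr_fun (hS i j) fun x hx => setIntegral_congr_fun (hS k l) fun y hy => ?_
      have hx' : bipodeIndex c₀ (ψ x) = j := hx.2
      have hy' : bipodeIndex c₀ (ψ y) = l := hy.2
      simp only [bipodal_eq, hx', hy']
    rw [f1, setIntegral_setIntegral_sub_const hg] at e1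
    rw [f2, setIntegral_setIntegral_sub_const hg] at e2
    change |_| * volume.real (S i j) * volume.real (S k l) ≤ _
    rw [← abs_of_nonneg (measureReal_nonneg (μ := volume) (s := S i j)),
      ← abs_of_nonneg (measureReal_nonneg (μ := volume) (s := S k l)), ← abs_mul, ← abs_mul]
    rw [abs_le] at e1 e2 ⊢
    constructor <;> linarith [e1.1, e1.2, e2.1, e2.2]

/-! ### Tripodal optimizers that converge to a bipodal graphon -/

/-- No tripodal graphon with the same edge density and at most as many triangles has more
entropy. -/
def IsMaximalTripodal (ap am b c d : ℝ) : Prop :=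
  ∀ ap' am' b' c' d' : ℝ, ap' ∈ Set.Icc (0 : ℝ) 1 → am' ∈ Set.Icc (0 : ℝ) 1 →
    b' ∈ Set.Icc (0 : ℝ) 1 → c' ∈ Set.Icc (0 : ℝ) 1 → d' ∈ Set.Icc (0 : ℝ) 1 →
    triEdge ap' am' b' c' d' = triEdge ap am b c d →
    triTriangle ap' am' b' c' d' ≤ triTriangle ap am b c d →
    triEntropy ap' am' b' c' d' ≤ triEntropy ap am b c d

/-- A sequence of tripodal optimizers with Lagrange multipliers `α` and `β` in which the first two
podes merge, and whose limit is of type `B(1,1)`. -/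
structure IsMergingSequence (ap am b c d α β : ℕ → ℝ) (a₀ b₀ c₀ d₀ : ℝ) : Prop where
  ne : ∀ n, ap n ≠ am n
  c_mem : ∀ n, c n ∈ Set.Ioo (0 : ℝ) 1
  critical : ∀ n, IsCriticalTripodal (ap n) (am n) (b n) (c n) (d n) (α n) (β n)
  maximal : ∀ n, IsMaximalTripodal (ap n) (am n) (b n) (c n) (d n)
  limit : IsB11 a₀ b₀ c₀ d₀
  tendsto_ap : Tendsto ap atTop (𝓝 a₀)
  tendsto_am : Tendsto am atTop (𝓝 a₀)
  tendsto_b : Tendsto b atTop (𝓝 b₀)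
  tendsto_c : Tendsto c atTop (𝓝 c₀)
  tendsto_d : Tendsto d atTop (𝓝 d₀)

/-- If a tripodal and a bipodal graphon of type `B(1,1)` agree on the overlaps of their podes, then
the first two podes of the tripodal graphon merge into one pode of the bipodal graphon. -/
lemma eq_of_overlap {ap am b c d a₀ b₀ c₀ d₀ : ℝ} (h₀ : IsB11 a₀ b₀ c₀ d₀)
    {x : Fin 3 → Fin 2 → ℝ} (hrow : ∀ i, ∑ j, x i j = podeSize c i)
    (hcol : ∀ j, ∑ i, x i j = bipodeSize c₀ j)
    (hx : ∀ i j k l, x i j ≠ 0 → x k l ≠ 0 →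
      podeValue ap am b d i k = bipodeValue a₀ b₀ d₀ j l) :
    ap = am ∧ ((am = a₀ ∧ b = b₀ ∧ c = c₀ ∧ d = d₀) ∨
      (am = b₀ ∧ b = a₀ ∧ c = 1 - c₀ ∧ d = d₀)) := by
  have hc0 : 0 < c₀ := h₀.c_mem.1
  have hc1 : 0 < 1 - c₀ := by linarith [h₀.c_mem.2]
  have hnc := h₀.not_constant
  have hna := h₀.not_A20
  have r0 := hrow 0
  have r1 := hrow 1
  have r2 := hrow 2
  have s0 := hcol 0
  have s1 := hcol 1
  simp only [Fin.sum_univ_two, Fin.sum_univ_three, podeSize, bipodeSize, Matrix.cons_val_zero,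
    Matrix.cons_val_one, Matrix.cons_val] at r0 r1 r2 s0 s1
  -- A tripodal pode meeting both bipodal podes would force all three bipodal values to coincide.
  have single : ∀ i, x i 0 = 0 ∨ x i 1 = 0 := by
    intro i
    by_contra! h
    have e1 := hx i 0 i 0 h.1 h.1
    have e2 := hx i 1 i 1 h.2 h.2
    have e3 := hx i 0 i 1 h.1 h.2
    simp only [bipodeValue, Matrix.cons_val_zero, Matrix.cons_val_one] at e1 e2 e3
    exact hnc ⟨by linarith, by linarith⟩
  -- Used when the two interchangeable podes lie in different bipodal podes: then a₀ = b₀, and the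
  -- third pode is either negligible, so c₀ = 1/2, or forces a constant graphon. Both are excluded
  -- from type B(1,1).
  have half : ∀ {i k : Fin 3}, podeValue ap am b d i i = am → podeValue ap am b d k k = am →
      x i 0 ≠ 0 → x k 1 ≠ 0 → a₀ = am ∧ b₀ = am := by
    intro i k hi hk h1 h2
    have e1 := hx i 0 i 0 h1 h1
    have e2 := hx k 1 k 1 h2 h2
    simp only [bipodeValue, Matrix.cons_val_zero, Matrix.cons_val_one] at e1 e2
    exact ⟨by linarith, by linarith⟩
  have v00 : podeValue ap am b d 0 0 = am := by simp [podeValue]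
  have v11 : podeValue ap am b d 1 1 = am := by simp [podeValue]
  have v01 : podeValue ap am b d 0 1 = ap := by simp [podeValue]
  have v02 : podeValue ap am b d 0 2 = d := by simp [podeValue]
  have v12 : podeValue ap am b d 1 2 = d := by simp [podeValue]
  have v22 : podeValue ap am b d 2 2 = b := by simp [podeValue]
  have w00 : bipodeValue a₀ b₀ d₀ 0 0 = a₀ := by simp [bipodeValue]
  have w11 : bipodeValue a₀ b₀ d₀ 1 1 = b₀ := by simp [bipodeValue]
  have w01 : bipodeValue a₀ b₀ d₀ 0 1 = d₀ := by simp [bipodeValue]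
  have w10 : bipodeValue a₀ b₀ d₀ 1 0 = d₀ := by simp [bipodeValue]
  rcases single 0 with h0 | h0 <;> rcases single 1 with h1 | h1 <;> rcases single 2 with h2 | h2
  · exfalso; linarith
  · have y0 : x 0 1 ≠ 0 := by intro h; linarith
    have y1 : x 1 1 ≠ 0 := by intro h; linarith
    have y2 : x 2 0 ≠ 0 := by intro h; linarith
    have e1 := hx 0 1 0 1 y0 y0
    have e2 := hx 0 1 1 1 y0 y1
    have e3 := hx 0 1 2 0 y0 y2
    have e4 := hx 2 0 2 0 y2 y2
    refine ⟨by linarith, Or.inr ⟨by linarith, by linarith, by linarith, by linarith⟩⟩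
  · exfalso
    have y0 : x 0 1 ≠ 0 := by intro h; linarith
    have y1 : x 1 0 ≠ 0 := by intro h; linarith
    obtain ⟨f1, f2⟩ := half v11 v00 y1 y0
    by_cases y2 : x 2 1 = 0
    · exact hna ⟨by linarith, by linarith⟩
    · have e1 := hx 0 1 2 1 y0 y2
      have e2 := hx 1 0 2 1 y1 y2
      exact hnc ⟨by linarith, by linarith⟩
  · exfalso
    have y0 : x 0 1 ≠ 0 := by intro h; linarith
    have y1 : x 1 0 ≠ 0 := by intro h; linarith
    obtain ⟨f1, f2⟩ := half v11 v00 y1 y0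
    by_cases y2 : x 2 0 = 0
    · exact hna ⟨by linarith, by linarith⟩
    · have e1 := hx 0 1 2 0 y0 y2
      have e2 := hx 1 0 2 0 y1 y2
      exact hnc ⟨by linarith, by linarith⟩
  · exfalso
    have y0 : x 0 0 ≠ 0 := by intro h; linarith
    have y1 : x 1 1 ≠ 0 := by intro h; linarith
    obtain ⟨f1, f2⟩ := half v00 v11 y0 y1
    by_cases y2 : x 2 1 = 0
    · exact hna ⟨by linarith, by linarith⟩
    · have e1 := hx 0 0 2 1 y0 y2
      have e2 := hx 1 1 2 1 y1 y2
      exact hnc ⟨by linarith, by linarith⟩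
  · exfalso
    have y0 : x 0 0 ≠ 0 := by intro h; linarith
    have y1 : x 1 1 ≠ 0 := by intro h; linarith
    obtain ⟨f1, f2⟩ := half v00 v11 y0 y1
    by_cases y2 : x 2 0 = 0
    · exact hna ⟨by linarith, by linarith⟩
    · have e1 := hx 0 0 2 0 y0 y2
      have e2 := hx 1 1 2 0 y1 y2
      exact hnc ⟨by linarith, by linarith⟩
  · have y0 : x 0 0 ≠ 0 := by intro h; linarith
    have y1 : x 1 0 ≠ 0 := by intro h; linarith
    have y2 : x 2 1 ≠ 0 := by intro h; linarith
    have e1 := hx 0 0 0 0 y0 y0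
    have e2 := hx 0 0 1 0 y0 y1
    have e3 := hx 0 0 2 1 y0 y2
    have e4 := hx 2 1 2 1 y2 y2
    refine ⟨by linarith, Or.inl ⟨by linarith, by linarith, by linarith, by linarith⟩⟩
  · exfalso; linarith

lemma IsB11.swap {a b c d : ℝ} (h : IsB11 a b c d) : IsB11 b a (1 - c) d where
  a_mem := h.b_mem
  b_mem := h.a_mem
  c_mem := ⟨by linarith [h.c_mem.2], by linarith [h.c_mem.1]⟩
  d_mem := h.d_mem
  not_constant h' := h.not_constant ⟨h'.2, h'.1⟩
  not_A20 h' := h.not_A20 ⟨h'.1.symm, by linarith [h'.2]⟩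

/-- Rearrangements need not converge, but the pode parameters and the finitely many overlaps lie in
a compact cube; their limits satisfy the hypotheses of `eq_of_overlap`. The limit may have its two
podes in the opposite order. -/
lemma exists_isMergingSequence {V : Set (ℝ × ℝ)} (hV : IsB21orC12Phase V) {p₀ : ℝ × ℝ}
    {a₀ b₀ c₀ d₀ : ℝ} (h₀ : IsB11 a₀ b₀ c₀ d₀)
    (hlim : IsLimitOfOptimizers V p₀ (bipodal a₀ b₀ c₀ d₀)) :
    ∃ (ap am b c d α β : ℕ → ℝ) (a₁ b₁ c₁ d₁ : ℝ),
      IsMergingSequence ap am b c d α β a₁ b₁ c₁ d₁ := by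
  obtain ⟨p, g, hpV, hg, -, hcut⟩ := hlim
  choose ap am b c d α β hB hopt hcrit using fun n => hV.exists_isCriticalTripodal (hpV n)
  have hmax : ∀ n, IsMaximalTripodal (ap n) (am n) (b n) (c n) (d n) := by
    intro n ap' am' b' c' d' h1 h2 h3 h4 h5 he ht
    have hc := Set.Ioo_subset_Icc_self (hB n).c_mem
    have e := (hopt n).1.edge
    have t := (hopt n).1.triangle
    rw [edgeDensity_tripodal hc] at e
    rw [triangleDensity_tripodal hc] at t
    have := (hopt n).1.triEntropy_le_entropy (hV.below _ (hpV n)).le h1 h2 h3 h4 h5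
      (he.trans e) (ht.trans t.le)
    rwa [entropy_tripodal hc] at this
  -- Slack for choosing a rearrangement, since the infimum defining the cut distance need not be
  -- attained. The distance to the tripodal representative is 0 by uniqueness.
  let r : ℕ → ℝ := fun n => 1 / ((n : ℝ) + 1)
  have hr : ∀ n, 0 < r n := fun n => by positivity
  have hr0 : Tendsto r atTop (𝓝 0) := tendsto_one_div_add_atTop_nhds_zero_nat
  choose x hx01 hxrow hxcol hx using fun n => exists_overlap (hg n).isGraphon (hB n) h₀
    (r₁ := r n) (r₂ := cutDist (g n) (bipodal a₀ b₀ c₀ d₀) + r n)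
    (by rw [(hopt n).2 _ (hg n)]; exact hr n) (by linarith [hr n])
  let z : ℕ → (Fin 5 → ℝ) × (Fin 3 → Fin 2 → ℝ) :=
    fun n => (![ap n, am n, b n, c n, d n], x n)
  have hz : ∀ n, z n ∈ Set.Icc (0 : (Fin 5 → ℝ) × (Fin 3 → Fin 2 → ℝ)) 1 := by
    intro n
    have k1 := (hB n).ap_mem
    have k2 := (hB n).am_mem
    have k3 := (hB n).b_mem
    have k4 := (hB n).c_mem
    have k5 := (hB n).d_mem
    refine ⟨⟨fun i => ?_, fun i j => (hx01 n i j).1⟩, ⟨fun i => ?_, fun i j => (hx01 n i j).2⟩⟩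
    · fin_cases i
      exacts [k1.1, k2.1, k3.1, k4.1.le, k5.1]
    · fin_cases i
      exacts [k1.2, k2.2, k3.2, k4.2.le, k5.2]
  obtain ⟨⟨y, X⟩, -, φ, hφ, hlimz⟩ := isCompact_Icc.tendsto_subseq hz
  have hy := (continuous_fst.tendsto _).comp hlimz
  have hX := (continuous_snd.tendsto _).comp hlimz
  have ty := tendsto_pi_nhds.1 hy
  have tX : ∀ i j, Tendsto (fun n => x (φ n) i j) atTop (𝓝 (X i j)) := fun i j =>
    tendsto_pi_nhds.1 (tendsto_pi_nhds.1 hX i) j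
  have tap : Tendsto (fun n => ap (φ n)) atTop (𝓝 (y 0)) := ty 0
  have tam : Tendsto (fun n => am (φ n)) atTop (𝓝 (y 1)) := ty 1
  have tb : Tendsto (fun n => b (φ n)) atTop (𝓝 (y 2)) := ty 2
  have tc : Tendsto (fun n => c (φ n)) atTop (𝓝 (y 3)) := ty 3
  have td : Tendsto (fun n => d (φ n)) atTop (𝓝 (y 4)) := ty 4
  have tv : ∀ i k, Tendsto (fun n => podeValue (ap (φ n)) (am (φ n)) (b (φ n)) (d (φ n)) i k) atTop
      (𝓝 (podeValue (y 0) (y 1) (y 2) (y 4) i k)) := by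
    intro i k
    fin_cases i <;> fin_cases k
    exacts [tam, tap, td, tap, tam, td, td, td, tb]
  have tr : Tendsto (fun n => r (φ n) + (cutDist (g (φ n)) (bipodal a₀ b₀ c₀ d₀) + r (φ n))) atTop
      (𝓝 (0 + (0 + 0))) := by
    have h1 := hr0.comp hφ.tendsto_atTop
    exact h1.add ((hcut.comp hφ.tendsto_atTop).add h1)
  have hrow : ∀ i, ∑ j, X i j = podeSize (y 3) i := by
    intro i
    have t1 := tendsto_finsetSum Finset.univ fun j _ => tX i j
    have t2 : Tendsto (fun n => podeSize (c (φ n)) i) atTop (𝓝 (podeSize (y 3) i)) := by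
      fin_cases i
      exacts [tc.div_const 2, tc.div_const 2, tc.const_sub 1]
    simp only [hxrow] at t1
    exact tendsto_nhds_unique t1 t2
  have hcol : ∀ j, ∑ i, X i j = bipodeSize c₀ j := by
    intro j
    have t1 := tendsto_finsetSum Finset.univ fun i _ => tX i j
    simp only [hxcol] at t1
    exact tendsto_nhds_unique t1 tendsto_const_nhds
  have hprod : ∀ i j k l, X i j ≠ 0 → X k l ≠ 0 →
      podeValue (y 0) (y 1) (y 2) (y 4) i k = bipodeValue a₀ b₀ d₀ j l := by
    intro i j k l h1 h2
    have t1 := (((tv i k).sub_const (bipodeValue a₀ b₀ d₀ j l)).abs.mul (tX i j)).mul (tX k l)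
    have h3 := le_of_tendsto_of_tendsto' t1 tr fun n => hx (φ n) i j k l
    have X1 : 0 < X i j := lt_of_le_of_ne (ge_of_tendsto' (tX i j) fun n => (hx01 _ i j).1) h1.symm
    have X2 : 0 < X k l := lt_of_le_of_ne (ge_of_tendsto' (tX k l) fun n => (hx01 _ k l).1) h2.symm
    rw [mul_assoc] at h3
    have h4 := nonpos_of_mul_nonpos_left (by simpa using h3) (mul_pos X1 X2)
    exact sub_eq_zero.1 (abs_nonpos_iff.1 h4)
  obtain ⟨e1, h⟩ := eq_of_overlap h₀ hrow hcol hprod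
  have hB₁ : IsB11 (y 1) (y 2) (y 3) (y 4) := by
    rcases h with ⟨h1, h2, h3, h4⟩ | ⟨h1, h2, h3, h4⟩ <;> rw [h1, h2, h3, h4]
    exacts [h₀, h₀.swap]
  exact ⟨fun n => ap (φ n), fun n => am (φ n), fun n => b (φ n), fun n => c (φ n),
    fun n => d (φ n), fun n => α (φ n), fun n => β (φ n), y 1, y 2, y 3, y 4,
    { ne := fun n => (hB _).ne
      c_mem := fun n => (hB _).c_mem
      critical := fun n => hcrit _
      maximal := fun n => hmax _
      limit := hB₁
      tendsto_ap := e1 ▸ tap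
      tendsto_am := tam
      tendsto_b := tb
      tendsto_c := tc
      tendsto_d := td }⟩

/-! ### Properties of the limit of a merging sequence -/

/-- First-order and global necessary conditions on a bipodal graphon that is the limit of tripodal
optimizers with unbounded Lagrange multipliers. -/
structure IsCriticalBipodal (a b c d : ℝ) : Prop where
  isB11 : IsB11 a b c d
  ad : c * a * d + (1 - c) * d * b < c * a ^ 2 + (1 - c) * d ^ 2 → a = 0 ∨ d = 1
  da : c * a ^ 2 + (1 - c) * d ^ 2 < c * a * d + (1 - c) * d * b → d = 0 ∨ a = 1
  bd : c * a * d + (1 - c) * d * b < c * d ^ 2 + (1 - c) * b ^ 2 → b = 0 ∨ d = 1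
  db : c * d ^ 2 + (1 - c) * b ^ 2 < c * a * d + (1 - c) * d * b → d = 0 ∨ b = 1
  ab : c * d ^ 2 + (1 - c) * b ^ 2 < c * a ^ 2 + (1 - c) * d ^ 2 → a = 0 ∨ b = 1
  ba : c * a ^ 2 + (1 - c) * d ^ 2 < c * d ^ 2 + (1 - c) * b ^ 2 → b = 0 ∨ a = 1
  size_a : a ∈ Set.Ioo (0 : ℝ) 1 →
    3 * c ^ 2 * a ^ 3 + 3 * (2 * c - 3 * c ^ 2) * d ^ 2 * a +
      3 * (1 - c) * (1 - 3 * c) * b * d ^ 2 - 3 * (1 - c) ^ 2 * b ^ 3 =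
    3 * (c * a ^ 2 + (1 - c) * d ^ 2) * (2 * c * a + 2 * (1 - 2 * c) * d - 2 * (1 - c) * b)
  size_b : b ∈ Set.Ioo (0 : ℝ) 1 →
    3 * c ^ 2 * a ^ 3 + 3 * (2 * c - 3 * c ^ 2) * d ^ 2 * a +
      3 * (1 - c) * (1 - 3 * c) * b * d ^ 2 - 3 * (1 - c) ^ 2 * b ^ 3 =
    3 * (c * d ^ 2 + (1 - c) * b ^ 2) * (2 * c * a + 2 * (1 - 2 * c) * d - 2 * (1 - c) * b)
  maximal : ∀ ap' am' b' c' d' : ℝ, ap' ∈ Set.Icc (0 : ℝ) 1 → am' ∈ Set.Icc (0 : ℝ) 1 →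
    b' ∈ Set.Icc (0 : ℝ) 1 → c' ∈ Set.Icc (0 : ℝ) 1 → d' ∈ Set.Icc (0 : ℝ) 1 →
    triEdge ap' am' b' c' d' = triEdge a a b c d →
    triTriangle ap' am' b' c' d' < triTriangle a a b c d →
    triEntropy ap' am' b' c' d' ≤ triEntropy a a b c d
  bipartite : triEdge a a b c d < 1 / 2 →
    Real.binEntropy (2 * triEdge a a b c d) / 4 ≤ triEntropy a a b c d

lemma IsCriticalBipodal.swap {a b c d : ℝ} (h : IsCriticalBipodal a b c d) :
    IsCriticalBipodal b a (1 - c) d := by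
  have he : triEdge b b a (1 - c) d = triEdge a a b c d := by unfold triEdge; ring
  have ht : triTriangle b b a (1 - c) d = triTriangle a a b c d := by unfold triTriangle; ring
  have hs : triEntropy b b a (1 - c) d = triEntropy a a b c d := by unfold triEntropy; ring
  exact
  { isB11 := h.isB11.swap
    ad := fun h' => h.bd (by linarith)
    da := fun h' => h.db (by linarith)
    bd := fun h' => h.ad (by linarith)
    db := fun h' => h.da (by linarith)
    ab := fun h' => h.ba (by linarith)
    ba := fun h' => h.ab (by linarith)
    size_a := fun h' => by linear_combination -h.size_b h'
    size_b := fun h' => by linear_combination -h.size_a h'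
    maximal := by rw [he, ht, hs]; exact h.maximal
    bipartite := by rw [he, hs]; exact h.bipartite }

/-- The difference of the two slopes is 6β(K - L) → ∞. This needs the slope of u to blow up, so u →
0, or that of v to tend to -∞, so v → 1. -/
lemma eq_zero_or_eq_one_of_tendsto {u v K L α β : ℕ → ℝ} {u₀ v₀ k l : ℝ}
    (hu : ∀ n, u n ∈ Set.Ioo (0 : ℝ) 1) (hv : ∀ n, v n ∈ Set.Ioo (0 : ℝ) 1)
    (hus : ∀ n, entropySlope (u n) = 2 * α n + 6 * β n * K n)
    (hvs : ∀ n, entropySlope (v n) = 2 * α n + 6 * β n * L n)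
    (hβ : Tendsto β atTop atTop) (htu : Tendsto u atTop (𝓝 u₀)) (htv : Tendsto v atTop (𝓝 v₀))
    (htK : Tendsto K atTop (𝓝 k)) (htL : Tendsto L atTop (𝓝 l)) (hkl : l < k) :
    u₀ = 0 ∨ v₀ = 1 := by
  by_contra! h
  have hu0 : 0 < u₀ := lt_of_le_of_ne (ge_of_tendsto' htu fun n => (hu n).1.le) h.1.symm
  have hv1 : v₀ < 1 := lt_of_le_of_ne (le_of_tendsto' htv fun n => (hv n).2.le) h.2
  have t1 : Tendsto (fun n => 6 * β n * (K n - L n)) atTop atTop :=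
    Tendsto.atTop_mul_pos (sub_pos.2 hkl) (hβ.const_mul_atTop (by norm_num)) (htK.sub htL)
  have t2 : Tendsto (fun n => -Real.log (u n) - Real.log (1 - v n)) atTop
      (𝓝 (-Real.log u₀ - Real.log (1 - v₀))) := by
    refine Tendsto.sub ((Real.continuousAt_log hu0.ne').tendsto.comp htu).neg ?_
    exact (Real.continuousAt_log (by linarith)).tendsto.comp (htv.const_sub 1)
  obtain ⟨n, hn1, hn2⟩ := ((t1.eventually_gt_atTop (-Real.log u₀ - Real.log (1 - v₀) + 1)).and
    (t2.eventually (gt_mem_nhds (lt_add_one _)))).exists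
  have h1 := hus n
  have h2 := hvs n
  have h3 : Real.log (1 - u n) ≤ 0 :=
    Real.log_nonpos (by linarith [(hu n).2]) (by linarith [(hu n).1])
  have h4 : Real.log (v n) ≤ 0 := Real.log_nonpos (hv n).1.le (hv n).2.le
  unfold entropySlope at h1 h2
  linarith

lemma eq_zero_of_tendsto_mul {β f : ℕ → ℝ} {x y : ℝ} (hβ : Tendsto β atTop atTop)
    (hf : Tendsto f atTop (𝓝 x)) (h : Tendsto (fun n => β n * f n) atTop (𝓝 y)) : x = 0 := by
  have h1 := h.mul (tendsto_inv_atTop_zero.comp hβ)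
  rw [mul_zero] at h1
  refine tendsto_nhds_unique hf (h1.congr' ?_)
  filter_upwards [hβ.eventually_gt_atTop 0] with n hn
  simp only [Function.comp]
  field_simp

lemma triTriangle_nonneg {ap am b c d : ℝ} (hap : 0 ≤ ap) (ham : 0 ≤ am) (hb : 0 ≤ b)
    (hc : c ∈ Set.Icc (0 : ℝ) 1) : 0 ≤ triTriangle ap am b c d := by
  have hk : 0 ≤ 1 - c := by linarith [hc.2]
  have hc0 := hc.1
  have e : (am + ap) ^ 3 + (am - ap) ^ 3 = 2 * am ^ 3 + 6 * am * ap ^ 2 := by ring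
  unfold triTriangle
  rw [e]
  positivity

lemma IsB11.triEdge_mem_Ioo {a b c d : ℝ} (h : IsB11 a b c d) :
    triEdge a a b c d ∈ Set.Ioo (0 : ℝ) 1 := by
  have hm := triEdge_mem h.a_mem h.a_mem h.b_mem (Set.Ioo_subset_Icc_self h.c_mem) h.d_mem
  have hc0 := h.c_mem.1
  have hk0 : 0 < 1 - c := by linarith [h.c_mem.2]
  have w1 : 0 < c ^ 2 := by positivity
  have w2 : 0 < 2 * c * (1 - c) := by positivity
  have w3 : 0 < (1 - c) ^ 2 := by positivity
  refine ⟨lt_of_le_of_ne hm.1 fun h0 => ?_, lt_of_le_of_ne hm.2 fun h1 => ?_⟩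
  · have e : c ^ 2 * a + 2 * c * (1 - c) * d + (1 - c) ^ 2 * b = 0 := by
      rw [h0]; unfold triEdge; ring
    have p1 := mul_nonneg w1.le h.a_mem.1
    have p2 := mul_nonneg w2.le h.d_mem.1
    have p3 := mul_nonneg w3.le h.b_mem.1
    have ea : a = 0 := (mul_eq_zero.1 (by linarith : c ^ 2 * a = 0)).resolve_left w1.ne'
    have ed : d = 0 := (mul_eq_zero.1 (by linarith : 2 * c * (1 - c) * d = 0)).resolve_left w2.ne'
    have eb : b = 0 := (mul_eq_zero.1 (by linarith : (1 - c) ^ 2 * b = 0)).resolve_left w3.ne'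
    exact h.not_constant ⟨by rw [ea, ed], by rw [eb, ed]⟩
  · have e : c ^ 2 * (1 - a) + 2 * c * (1 - c) * (1 - d) + (1 - c) ^ 2 * (1 - b) = 0 := by
      have : c ^ 2 * (1 - a) + 2 * c * (1 - c) * (1 - d) + (1 - c) ^ 2 * (1 - b) =
        1 - triEdge a a b c d := by unfold triEdge; ring
      rw [this, h1, sub_self]
    have p1 := mul_nonneg w1.le (sub_nonneg.2 h.a_mem.2)
    have p2 := mul_nonneg w2.le (sub_nonneg.2 h.d_mem.2)
    have p3 := mul_nonneg w3.le (sub_nonneg.2 h.b_mem.2)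
    have ea : 1 - a = 0 :=
      (mul_eq_zero.1 (by linarith : c ^ 2 * (1 - a) = 0)).resolve_left w1.ne'
    have ed : 1 - d = 0 :=
      (mul_eq_zero.1 (by linarith : 2 * c * (1 - c) * (1 - d) = 0)).resolve_left w2.ne'
    have eb : 1 - b = 0 :=
      (mul_eq_zero.1 (by linarith : (1 - c) ^ 2 * (1 - b) = 0)).resolve_left w3.ne'
    exact h.not_constant ⟨by linarith, by linarith⟩

/-! ### Passage to the limit along a merging sequence -/

section

variable {ap am b c d α β : ℕ → ℝ} {a₀ b₀ c₀ d₀ : ℝ}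

/-- Two podes can only merge if the multiplier of the triangle constraint diverges. -/
lemma IsMergingSequence.tendsto_multiplier
    (h : IsMergingSequence ap am b c d α β a₀ b₀ c₀ d₀) : Tendsto β atTop atTop := by
  have h1 : Tendsto (fun n => 3 * |am n - ap n|) atTop (𝓝[>] 0) := by
    refine tendsto_nhdsWithin_iff.2 ⟨?_, Eventually.of_forall fun n => ?_⟩
    · simpa using (h.tendsto_am.sub h.tendsto_ap).abs.const_mul 3
    · have := abs_pos.2 (sub_ne_zero.2 (h.ne n).symm)
      exact mul_pos (by norm_num) this
  refine tendsto_atTop_mono (fun n => ?_) (tendsto_inv_nhdsGT_zero.comp h1)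
  have hpos := abs_pos.2 (sub_ne_zero.2 (h.ne n).symm)
  have hc := h.critical n
  have e := abs_sub_le_abs_entropySlope_sub hc.am_mem hc.ap_mem
  -- The codegrees of the two kinds of blocks inside the merging podes differ by c(am - ap)²/2,
  -- quadratically small, while the slopes differ by at least |am - ap|.
  have e2 : entropySlope (am n) - entropySlope (ap n) =
      3 * β n * c n * (|am n - ap n| * |am n - ap n|) := by
    rw [abs_mul_abs_self, hc.slope_am, hc.slope_ap]; ring
  have hβ := hc.nonneg
  have hcn := h.c_mem n
  rw [e2, abs_of_nonneg (mul_nonneg (mul_nonneg (by positivity) hcn.1.le) (by positivity))] at e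
  have e3 : 1 ≤ 3 * β n * c n * |am n - ap n| := by
    refine le_of_mul_le_mul_right ?_ hpos
    linarith
  have e4 : 3 * β n * c n * |am n - ap n| ≤ 3 * β n * |am n - ap n| := by
    refine mul_le_mul_of_nonneg_right ?_ hpos.le
    nlinarith [hcn.2]
  simp only [Function.comp]
  rw [inv_le_iff_one_le_mul₀ (by positivity)]
  linarith

lemma continuous_triEdge :
    Continuous fun z : ℝ × ℝ × ℝ × ℝ × ℝ => triEdge z.1 z.2.1 z.2.2.1 z.2.2.2.1 z.2.2.2.2 := by
  unfold triEdge; fun_prop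

lemma continuous_triTriangle :
    Continuous fun z : ℝ × ℝ × ℝ × ℝ × ℝ => triTriangle z.1 z.2.1 z.2.2.1 z.2.2.2.1 z.2.2.2.2 := by
  unfold triTriangle; fun_prop

lemma continuous_triEntropy :
    Continuous fun z : ℝ × ℝ × ℝ × ℝ × ℝ => triEntropy z.1 z.2.1 z.2.2.1 z.2.2.2.1 z.2.2.2.2 := by
  unfold triEntropy; fun_prop

lemma IsMergingSequence.tendsto_params (h : IsMergingSequence ap am b c d α β a₀ b₀ c₀ d₀) :
    Tendsto (fun n => (ap n, am n, b n, c n, d n)) atTop (𝓝 (a₀, a₀, b₀, c₀, d₀)) :=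
  h.tendsto_ap.prodMk_nhds (h.tendsto_am.prodMk_nhds
    (h.tendsto_b.prodMk_nhds (h.tendsto_c.prodMk_nhds h.tendsto_d)))

lemma IsMergingSequence.tendsto_triEdge (h : IsMergingSequence ap am b c d α β a₀ b₀ c₀ d₀) :
    Tendsto (fun n => triEdge (ap n) (am n) (b n) (c n) (d n)) atTop
      (𝓝 (triEdge a₀ a₀ b₀ c₀ d₀)) := by
  have := (continuous_triEdge.tendsto (a₀, a₀, b₀, c₀, d₀)).comp h.tendsto_params
  exact this

/-- A strict deficit of triangles and a strict excess of entropy would survive a small correction of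
the edge density, contradicting optimality along the sequence. -/
lemma IsMergingSequence.triEntropy_le (h : IsMergingSequence ap am b c d α β a₀ b₀ c₀ d₀)
    {ap' am' b' c' d' : ℝ} (hap : ap' ∈ Set.Icc (0 : ℝ) 1) (ham : am' ∈ Set.Icc (0 : ℝ) 1)
    (hb : b' ∈ Set.Icc (0 : ℝ) 1) (hc : c' ∈ Set.Icc (0 : ℝ) 1) (hd : d' ∈ Set.Icc (0 : ℝ) 1)
    (he : triEdge ap' am' b' c' d' = triEdge a₀ a₀ b₀ c₀ d₀)
    (ht : triTriangle ap' am' b' c' d' < triTriangle a₀ a₀ b₀ c₀ d₀) :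
    triEntropy ap' am' b' c' d' ≤ triEntropy a₀ a₀ b₀ c₀ d₀ := by
  by_contra! hs
  obtain ⟨e0, e1⟩ := h.limit.triEdge_mem_Ioo
  set e := triEdge a₀ a₀ b₀ c₀ d₀ with hedef
  let E : ℕ → ℝ := fun n => triEdge (ap n) (am n) (b n) (c n) (d n)
  have tE : Tendsto E atTop (𝓝 e) := h.tendsto_triEdge
  have hE : ∀ n, E n ∈ Set.Icc (0 : ℝ) 1 := fun n =>
    triEdge_mem (Set.Ioo_subset_Icc_self (h.critical n).ap_mem)
      (Set.Ioo_subset_Icc_self (h.critical n).am_mem)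
      (Set.Ioo_subset_Icc_self (h.critical n).b_mem) (Set.Ioo_subset_Icc_self (h.c_mem n))
      (Set.Ioo_subset_Icc_self (h.critical n).d_mem)
  -- The largest factor for which u ↦ E + s(u - e) maps [0,1] into itself; this map carries edge
  -- density `e` to `E n`.
  let s : ℕ → ℝ := fun n => min (E n / e) ((1 - E n) / (1 - e))
  have ts : Tendsto s atTop (𝓝 1) := by
    have t1 : Tendsto (fun n => E n / e) atTop (𝓝 1) := by
      simpa [e0.ne'] using tE.div_const e
    have t2 : Tendsto (fun n => (1 - E n) / (1 - e)) atTop (𝓝 1) := by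
      simpa [(sub_pos.2 e1).ne'] using (tE.const_sub 1).div_const (1 - e)
    simpa using t1.min t2
  let m : ℝ → ℕ → ℝ := fun u n => E n + s n * (u - e)
  have tm : ∀ u, Tendsto (m u) atTop (𝓝 u) := by
    intro u
    have := tE.add (ts.mul_const (u - e))
    simpa using this
  have hm : ∀ {u}, u ∈ Set.Icc (0 : ℝ) 1 → ∀ n, m u n ∈ Set.Icc (0 : ℝ) 1 := by
    intro u hu n
    have s0 : 0 ≤ s n := le_min (div_nonneg (hE n).1 e0.le)
      (div_nonneg (sub_nonneg.2 (hE n).2) (sub_nonneg.2 e1.le))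
    have s1 : s n * e ≤ E n := (le_div_iff₀ e0).1 (min_le_left _ _)
    have s2 : s n * (1 - e) ≤ 1 - E n := (le_div_iff₀ (sub_pos.2 e1)).1 (min_le_right _ _)
    have k1 := mul_nonneg s0 hu.1
    have k2 := mul_le_mul_of_nonneg_left hu.2 s0
    constructor <;> simp only [m] <;> linarith
  have tp : Tendsto (fun n => (m ap' n, m am' n, m b' n, c', m d' n)) atTop
      (𝓝 (ap', am', b', c', d')) :=
    (tm _).prodMk_nhds ((tm _).prodMk_nhds ((tm _).prodMk_nhds
      (tendsto_const_nhds.prodMk_nhds (tm _))))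
  have ev1 := ((continuous_triTriangle.tendsto (ap', am', b', c', d')).comp tp).eventually_lt
    ((continuous_triTriangle.tendsto (a₀, a₀, b₀, c₀, d₀)).comp h.tendsto_params) ht
  have ev2 := ((continuous_triEntropy.tendsto (a₀, a₀, b₀, c₀, d₀)).comp h.tendsto_params).eventually_lt
    ((continuous_triEntropy.tendsto (ap', am', b', c', d')).comp tp) hs
  obtain ⟨n, h1, h2⟩ := (ev1.and ev2).exists
  have hedge : triEdge (m ap' n) (m am' n) (m b' n) c' (m d' n) = E n := by
    have : triEdge (m ap' n) (m am' n) (m b' n) c' (m d' n) =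
        E n + s n * (triEdge ap' am' b' c' d' - e) := by
      simp only [triEdge, m]; ring
    rw [this, he]; ring
  have := h.maximal n _ _ _ _ _ (hm hap n) (hm ham n) (hm hb n) hc (hm hd n) hedge h1.le
  exact absurd h2 (not_lt.2 this)

/-- The competitor is the balanced bipartite graphon of the same edge density, which has no
triangles. The comparison is made before the limit, because a limit without triangles admits no
competitor with strictly fewer. -/
lemma IsMergingSequence.binEntropy_le (h : IsMergingSequence ap am b c d α β a₀ b₀ c₀ d₀)
    (he : triEdge a₀ a₀ b₀ c₀ d₀ < 1 / 2) :
    Real.binEntropy (2 * triEdge a₀ a₀ b₀ c₀ d₀) / 4 ≤ triEntropy a₀ a₀ b₀ c₀ d₀ := by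
  have tE := h.tendsto_triEdge
  refine le_of_tendsto_of_tendsto
    (((Real.binEntropy_continuous.tendsto _).comp (tE.const_mul 2)).div_const 4)
    ((continuous_triEntropy.tendsto (a₀, a₀, b₀, c₀, d₀)).comp h.tendsto_params) ?_
  filter_upwards [tE.eventually (gt_mem_nhds he)] with n hn
  have hc := h.critical n
  have hcn := Set.Ioo_subset_Icc_self (h.c_mem n)
  have h0 : (0 : ℝ) ∈ Set.Icc (0 : ℝ) 1 := by simp
  have hE := triEdge_mem (Set.Ioo_subset_Icc_self hc.ap_mem)
      (Set.Ioo_subset_Icc_self hc.am_mem) (Set.Ioo_subset_Icc_self hc.b_mem) hcn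
      (Set.Ioo_subset_Icc_self hc.d_mem)
  have := h.maximal n 0 0 0 (1 / 2) (2 * triEdge (ap n) (am n) (b n) (c n) (d n)) h0 h0 h0
    ⟨by norm_num, by norm_num⟩ ⟨by linarith [hE.1], by linarith⟩
    (by simp only [triEdge]; ring)
    (by
      have := triTriangle_nonneg (d := d n) hc.ap_mem.1.le hc.am_mem.1.le hc.b_mem.1.le hcn
      simpa [triTriangle] using this)
  have e : triEntropy 0 0 0 (1 / 2) (2 * triEdge (ap n) (am n) (b n) (c n) (d n)) =
      Real.binEntropy (2 * triEdge (ap n) (am n) (b n) (c n) (d n)) / 4 := by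
    simp [triEntropy]; ring
  rw [e] at this
  exact this

lemma IsMergingSequence.isCriticalBipodal
    (h : IsMergingSequence ap am b c d α β a₀ b₀ c₀ d₀) : IsCriticalBipodal a₀ b₀ c₀ d₀ := by
  have hβ := h.tendsto_multiplier
  have tp := h.tendsto_params
  have lim : ∀ {f : ℝ × ℝ × ℝ × ℝ × ℝ → ℝ}, Continuous f → ∀ {y : ℝ},
      f (a₀, a₀, b₀, c₀, d₀) = y →
      Tendsto (fun n => f (ap n, am n, b n, c n, d n)) atTop (𝓝 y) :=
    fun hf y hy => hy ▸ (hf.tendsto _).comp tp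
  have tA : Tendsto (fun n => c n * ((am n ^ 2 + ap n ^ 2) / 2) + (1 - c n) * d n ^ 2) atTop
      (𝓝 (c₀ * a₀ ^ 2 + (1 - c₀) * d₀ ^ 2)) :=
    lim (f := fun z => z.2.2.2.1 * ((z.2.1 ^ 2 + z.1 ^ 2) / 2) + (1 - z.2.2.2.1) * z.2.2.2.2 ^ 2)
      (by fun_prop) (by ring)
  have tB : Tendsto (fun n => c n * d n ^ 2 + (1 - c n) * b n ^ 2) atTop
      (𝓝 (c₀ * d₀ ^ 2 + (1 - c₀) * b₀ ^ 2)) :=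
    lim (f := fun z => z.2.2.2.1 * z.2.2.2.2 ^ 2 + (1 - z.2.2.2.1) * z.2.2.1 ^ 2)
      (by fun_prop) (by ring)
  have tD : Tendsto (fun n => c n * d n * ((am n + ap n) / 2) + (1 - c n) * d n * b n) atTop
      (𝓝 (c₀ * a₀ * d₀ + (1 - c₀) * d₀ * b₀)) :=
    lim (f := fun z => z.2.2.2.1 * z.2.2.2.2 * ((z.2.1 + z.1) / 2) +
      (1 - z.2.2.2.1) * z.2.2.2.2 * z.2.2.1) (by fun_prop) (by ring)
  have ma := fun n => (h.critical n).am_mem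
  have mb := fun n => (h.critical n).b_mem
  have md := fun n => (h.critical n).d_mem
  have sa := fun n => (h.critical n).slope_am
  have sb := fun n => (h.critical n).slope_b
  have sd := fun n => (h.critical n).slope_d
  have te : Tendsto (fun n => c n * (am n + ap n) + 2 * (1 - 2 * c n) * d n - 2 * (1 - c n) * b n)
      atTop (𝓝 (2 * c₀ * a₀ + 2 * (1 - 2 * c₀) * d₀ - 2 * (1 - c₀) * b₀)) :=
    lim (f := fun z => z.2.2.2.1 * (z.2.1 + z.1) + 2 * (1 - 2 * z.2.2.2.1) * z.2.2.2.2 -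
      2 * (1 - z.2.2.2.1) * z.2.2.1) (by fun_prop) (by ring)
  have tt : Tendsto (fun n => 3 * c n ^ 2 / 8 * ((am n + ap n) ^ 3 + (am n - ap n) ^ 3) +
      3 / 2 * (2 * c n - 3 * c n ^ 2) * d n ^ 2 * (am n + ap n) +
      3 * (1 - c n) * (1 - 3 * c n) * b n * d n ^ 2 - 3 * (1 - c n) ^ 2 * b n ^ 3) atTop
      (𝓝 (3 * c₀ ^ 2 * a₀ ^ 3 + 3 * (2 * c₀ - 3 * c₀ ^ 2) * d₀ ^ 2 * a₀ +
        3 * (1 - c₀) * (1 - 3 * c₀) * b₀ * d₀ ^ 2 - 3 * (1 - c₀) ^ 2 * b₀ ^ 3)) :=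
    lim (f := fun z => 3 * z.2.2.2.1 ^ 2 / 8 * ((z.2.1 + z.1) ^ 3 + (z.2.1 - z.1) ^ 3) +
      3 / 2 * (2 * z.2.2.2.1 - 3 * z.2.2.2.1 ^ 2) * z.2.2.2.2 ^ 2 * (z.2.1 + z.1) +
      3 * (1 - z.2.2.2.1) * (1 - 3 * z.2.2.2.1) * z.2.2.1 * z.2.2.2.2 ^ 2 -
      3 * (1 - z.2.2.2.1) ^ 2 * z.2.2.1 ^ 3) (by fun_prop) (by ring)
  have tS : Tendsto (fun n => c n / 2 * (Real.binEntropy (am n) + Real.binEntropy (ap n)) +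
      (1 - 2 * c n) * Real.binEntropy (d n) - (1 - c n) * Real.binEntropy (b n)) atTop
      (𝓝 (c₀ / 2 * (Real.binEntropy a₀ + Real.binEntropy a₀) +
        (1 - 2 * c₀) * Real.binEntropy d₀ - (1 - c₀) * Real.binEntropy b₀)) :=
    lim (f := fun z => z.2.2.2.1 / 2 * (Real.binEntropy z.2.1 + Real.binEntropy z.1) +
      (1 - 2 * z.2.2.2.1) * Real.binEntropy z.2.2.2.2 - (1 - z.2.2.2.1) * Real.binEntropy z.2.2.1)
      (by fun_prop) rfl
  -- A value with interior limit has bounded slope, so α can be eliminated from the size equation.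
  -- What remains equates β times a convergent expression to a bounded quantity, and the expression
  -- must tend to 0.
  have size : ∀ {u K : ℕ → ℝ} {u₀ k : ℝ}, u₀ ∈ Set.Ioo (0 : ℝ) 1 → Tendsto u atTop (𝓝 u₀) →
      Tendsto K atTop (𝓝 k) → (∀ n, entropySlope (u n) = 2 * α n + 6 * β n * K n) →
      3 * c₀ ^ 2 * a₀ ^ 3 + 3 * (2 * c₀ - 3 * c₀ ^ 2) * d₀ ^ 2 * a₀ +
        3 * (1 - c₀) * (1 - 3 * c₀) * b₀ * d₀ ^ 2 - 3 * (1 - c₀) ^ 2 * b₀ ^ 3 =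
      3 * k * (2 * c₀ * a₀ + 2 * (1 - 2 * c₀) * d₀ - 2 * (1 - c₀) * b₀) := by
    intro u K u₀ k hu₀ hu hK hs
    have t1 := tt.sub ((hK.const_mul 3).mul te)
    have t2 := tS.sub ((((continuousAt_entropySlope hu₀).tendsto.comp hu).div_const 2).mul te)
    refine sub_eq_zero.1 (eq_zero_of_tendsto_mul hβ t1 (t2.congr fun n => ?_))
    rw [(h.critical n).size]
    simp only [Function.comp, hs n]
    ring
  exact
  { isB11 := h.limit
    ad := eq_zero_or_eq_one_of_tendsto ma md sa sd hβ h.tendsto_am h.tendsto_d tA tD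
    da := eq_zero_or_eq_one_of_tendsto md ma sd sa hβ h.tendsto_d h.tendsto_am tD tA
    bd := eq_zero_or_eq_one_of_tendsto mb md sb sd hβ h.tendsto_b h.tendsto_d tB tD
    db := eq_zero_or_eq_one_of_tendsto md mb sd sb hβ h.tendsto_d h.tendsto_b tD tB
    ab := eq_zero_or_eq_one_of_tendsto ma mb sa sb hβ h.tendsto_am h.tendsto_b tA tB
    ba := eq_zero_or_eq_one_of_tendsto mb ma sb sa hβ h.tendsto_b h.tendsto_am tB tA
    size_a := fun ha => size ha h.tendsto_am tA sa
    size_b := fun hb => size hb h.tendsto_b tB sb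
    maximal := fun _ _ _ _ _ => h.triEntropy_le
    bipartite := h.binEntropy_le }

end

/-! ### Improving a critical bipodal graphon by splitting a pode -/

lemma exists_eventually_abs_sub_le_mul_sq {f : ℝ → ℝ} (hf : ContDiffAt ℝ 2 f 0)
    (h : HasDerivAt f 0 0) :
    ∃ K : ℝ, 0 ≤ K ∧ ∀ᶠ y in 𝓝 (0 : ℝ), |f y - f 0| ≤ K * y ^ 2 := by
  have h1 : DifferentiableAt ℝ (fderiv ℝ f) 0 :=
    (hf.fderiv_right (m := 1) (by norm_num)).differentiableAt (by norm_num)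
  obtain ⟨C, hC⟩ := h1.isBigO_sub.bound
  have h2 : ∀ᶠ y in 𝓝 (0 : ℝ), DifferentiableAt ℝ f y :=
    (hf.eventually (by simp)).mono fun y hy => hy.differentiableAt (by norm_num)
  have h3 : fderiv ℝ f 0 = 0 := by
    ext
    simpa using h.deriv
  obtain ⟨r, hr, hball⟩ := Metric.eventually_nhds_iff_ball.1 (hC.and h2)
  refine ⟨|C|, abs_nonneg C, ?_⟩
  filter_upwards [Metric.ball_mem_nhds (0 : ℝ) hr] with y hy
  have hsub : Metric.closedBall (0 : ℝ) |y| ⊆ Metric.ball 0 r :=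
    Metric.closedBall_subset_ball (by simpa using hy)
  have h4 := (convex_closedBall (0 : ℝ) |y|).norm_image_sub_le_of_norm_fderiv_le (𝕜 := ℝ)
    (f := f) (C := |C| * |y|) (fun x hx => (hball x (hsub hx)).2) (fun x hx => ?_)
    (x := 0) (y := y) (by simp) (by simp)
  · simp only [Real.norm_eq_abs, sub_zero] at h4
    calc |f y - f 0| ≤ |C| * |y| * |y| := h4
      _ = |C| * y ^ 2 := by rw [mul_assoc, abs_mul_abs_self, sq]
  · have h5 := (hball x (hsub hx)).1
    rw [h3, sub_zero, sub_zero] at h5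
    have h6 : ‖x‖ ≤ |y| := by simpa using hx
    calc _ ≤ C * ‖x‖ := h5
      _ ≤ |C| * |y| := mul_le_mul (le_abs_self C) h6 (norm_nonneg _) (abs_nonneg _)

section

variable {a b c d : ℝ → ℝ}

/-- Moving along the path by y gains entropy of order y and adds at most Ky² triangles. Splitting
the first pode by ± t removes c³t³ triangles at an entropy cost of order t². Any t with y^(2/3) ≪ t
≪ y^(1/2) wins on both counts. -/
lemma exists_better_tripodal_of_pos (ha0 : a 0 ∈ Set.Ioo (0 : ℝ) 1) (hc0 : c 0 ∈ Set.Ioo (0 : ℝ) 1)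
    (ha : ContDiffAt ℝ 2 a 0) (hb : ContDiffAt ℝ 2 b 0) (hc : ContDiffAt ℝ 2 c 0)
    (hd : ContDiffAt ℝ 2 d 0)
    (hmem : ∀ᶠ y in 𝓝 0, b y ∈ Set.Icc (0 : ℝ) 1 ∧ d y ∈ Set.Icc (0 : ℝ) 1)
    (he : ∀ᶠ y in 𝓝 0, triEdge (a y) (a y) (b y) (c y) (d y) =
      triEdge (a 0) (a 0) (b 0) (c 0) (d 0))
    (ht : HasDerivAt (fun y => triTriangle (a y) (a y) (b y) (c y) (d y)) 0 0) {r : ℝ}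
    (hs : HasDerivAt (fun y => triEntropy (a y) (a y) (b y) (c y) (d y)) r 0) (hr : 0 < r) :
    ∃ ap' am' b' c' d' : ℝ, ap' ∈ Set.Icc (0 : ℝ) 1 ∧ am' ∈ Set.Icc (0 : ℝ) 1 ∧
      b' ∈ Set.Icc (0 : ℝ) 1 ∧ c' ∈ Set.Icc (0 : ℝ) 1 ∧ d' ∈ Set.Icc (0 : ℝ) 1 ∧
      triEdge ap' am' b' c' d' = triEdge (a 0) (a 0) (b 0) (c 0) (d 0) ∧
      triTriangle ap' am' b' c' d' < triTriangle (a 0) (a 0) (b 0) (c 0) (d 0) ∧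
      triEntropy (a 0) (a 0) (b 0) (c 0) (d 0) < triEntropy ap' am' b' c' d' := by
  have htc : ContDiffAt ℝ 2 (fun y => triTriangle (a y) (a y) (b y) (c y) (d y)) 0 := by
    unfold triTriangle
    fun_prop
  obtain ⟨K, hK0, hK⟩ := exists_eventually_abs_sub_le_mul_sq htc ht
  have hS : ∀ᶠ y in 𝓝[>] (0 : ℝ), triEntropy (a 0) (a 0) (b 0) (c 0) (d 0) + r / 2 * y <
      triEntropy (a y) (a y) (b y) (c y) (d y) := by
    have h1 := (hasDerivAt_iff_tendsto_slope.1 hs).mono_left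
      (nhdsWithin_mono _ fun x (hx : x ∈ Set.Ioi 0) => ne_of_gt hx)
    filter_upwards [h1.eventually (lt_mem_nhds (half_lt_self hr)), self_mem_nhdsWithin]
      with y h2 hy
    have hy : (0 : ℝ) < y := hy
    rw [slope_def_field, sub_zero, lt_div_iff₀ hy] at h2
    linarith
  set m := a 0 * (1 - a 0) / 2 with hm
  have hm0 : 0 < m := by
    have := mul_pos ha0.1 (sub_pos.2 ha0.2)
    positivity
  have hav : ∀ᶠ y in 𝓝 0, m < a y * (1 - a y) :=
    (ha.continuousAt.mul (ha.continuousAt.const_sub 1)).eventually (lt_mem_nhds (by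
      have := mul_pos ha0.1 (sub_pos.2 ha0.2)
      simp only [hm, Pi.mul_apply]; linarith))
  have hcv : ∀ᶠ y in 𝓝 0, c y ∈ Set.Ioo (c 0 / 2) 1 :=
    hc.continuousAt.eventually (isOpen_Ioo.mem_nhds ⟨by linarith [hc0.1], hc0.2⟩)
  have hy5 : Tendsto (fun s : ℝ => s ^ 5) (𝓝 0) (𝓝 0) :=
    Continuous.tendsto' (by fun_prop) _ _ (by simp)
  have hy5' : Tendsto (fun s : ℝ => s ^ 5) (𝓝[>] 0) (𝓝[>] 0) := by
    refine tendsto_nhdsWithin_iff.2 ⟨hy5.mono_left nhdsWithin_le_nhds, ?_⟩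
    filter_upwards [self_mem_nhdsWithin] with s hs
    exact pow_pos (show (0 : ℝ) < s from hs) 5
  have hav5 := hy5.eventually hav
  have ht3 : ∀ᶠ s in 𝓝 (0 : ℝ), |s ^ 3| < a (s ^ 5) ∧ |s ^ 3| < 1 - a (s ^ 5) := by
    have t1 : Tendsto (fun s : ℝ => |s ^ 3|) (𝓝 0) (𝓝 0) :=
      Continuous.tendsto' (by fun_prop) _ _ (by simp)
    have t2 : Tendsto (fun s : ℝ => a (s ^ 5)) (𝓝 0) (𝓝 (a 0)) := ha.continuousAt.tendsto.comp hy5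
    exact (t1.eventually_lt t2 ha0.1).and (t1.eventually_lt (t2.const_sub 1) (sub_pos.2 ha0.2))
  have hsmall : ∀ᶠ s in 𝓝 (0 : ℝ), s < r * m / 2 ∧ K * s < (c 0 / 2) ^ 3 := by
    have h1 : 0 < r * m / 2 := by positivity
    have h2 : K * 0 < (c 0 / 2) ^ 3 := by
      have := hc0.1
      rw [mul_zero]; positivity
    exact (gt_mem_nhds h1).and
      ((Continuous.tendsto (by fun_prop : Continuous fun s : ℝ => K * s) 0).eventually
        (gt_mem_nhds h2))
  obtain ⟨s, h1, ⟨h2, h3, h4, h5, h6, h7, h8⟩, hspos⟩ :=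
    ((hy5'.eventually hS).and (((hav5.and ((hy5.eventually hcv).and (ht3.and (hsmall.and
      ((hy5.eventually hmem).and ((hy5.eventually he).and (hy5.eventually hK))))))).filter_mono
      nhdsWithin_le_nhds).and self_mem_nhdsWithin)).exists
  have hspos : (0 : ℝ) < s := hspos
  -- With t = s³, both ratios t²/y and y²/t³ equal s.
  set y := s ^ 5 with hy
  set t := s ^ 3 with ht'
  have ht0 : 0 < t := by positivity
  obtain ⟨k1, k2⟩ := h4
  rw [abs_of_pos ht0] at k1 k2
  have hcy := h3.1
  have hc00 := hc0.1
  refine ⟨a y + t, a y - t, b y, c y, d y, ⟨by linarith, by linarith⟩, ⟨by linarith, by linarith⟩,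
    h6.1, ⟨by linarith [h3.1], h3.2.le⟩, h6.2, ?_, ?_, ?_⟩
  · rw [← h7]; unfold triEdge; ring
  · have e : triTriangle (a y + t) (a y - t) (b y) (c y) (d y) =
        triTriangle (a y) (a y) (b y) (c y) (d y) - c y ^ 3 * t ^ 3 := by
      unfold triTriangle; ring
    have e1 := (abs_le.1 h8).2
    have e2 : (c 0 / 2) ^ 3 ≤ c y ^ 3 := pow_le_pow_left₀ (by positivity) hcy.le 3
    have e3 : K * y ^ 2 < c y ^ 3 * t ^ 3 := by
      have : K * s * s ^ 9 < c y ^ 3 * s ^ 9 :=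
        mul_lt_mul_of_pos_right (h5.2.trans_le e2) (by positivity)
      calc K * y ^ 2 = K * s * s ^ 9 := by rw [hy]; ring
        _ < c y ^ 3 * s ^ 9 := this
        _ = c y ^ 3 * t ^ 3 := by rw [ht']; ring
    linarith
  · have e := two_mul_binEntropy_sub_le (a := a y) (t := t) (by rwa [abs_of_pos ht0])
      (by rwa [abs_of_pos ht0])
    have e1 : 2 * t ^ 2 / (a y * (1 - a y)) ≤ 2 * t ^ 2 / m :=
      div_le_div_of_nonneg_left (by positivity) hm0 h2.le
    have e2 : c y ^ 2 / 4 * (2 * t ^ 2 / m) ≤ t ^ 2 / m := by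
      have hcy1 : c y ^ 2 ≤ 1 := pow_le_one₀ (by linarith) h3.2.le
      have : 0 ≤ t ^ 2 / m := by positivity
      have e3 : c y ^ 2 / 4 * (2 * t ^ 2 / m) = c y ^ 2 / 2 * (t ^ 2 / m) := by ring
      rw [e3]
      nlinarith
    have e3 : t ^ 2 / m < r / 2 * y := by
      rw [div_lt_iff₀ hm0, hy, ht']
      have : s * s ^ 5 < r * m / 2 * s ^ 5 := mul_lt_mul_of_pos_right h5.1 (by positivity)
      linarith
    have e4 : triEntropy (a y) (a y) (b y) (c y) (d y) - c y ^ 2 / 4 * (2 * t ^ 2 / m) ≤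
        triEntropy (a y + t) (a y - t) (b y) (c y) (d y) := by
      have := mul_le_mul_of_nonneg_left (e.trans' (sub_le_sub_left e1 _))
        (by positivity : 0 ≤ c y ^ 2 / 4)
      unfold triEntropy
      linarith
    linarith

/-- A critical bipodal graphon does not lie on a path with constant edge density along which the
number of triangles is stationary and the entropy is not. -/
lemma IsCriticalBipodal.eq_zero_of_hasDerivAt
    (h : IsCriticalBipodal (a 0) (b 0) (c 0) (d 0)) (ha0 : a 0 ∈ Set.Ioo (0 : ℝ) 1)
    (ha : ContDiffAt ℝ 2 a 0) (hb : ContDiffAt ℝ 2 b 0) (hc : ContDiffAt ℝ 2 c 0)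
    (hd : ContDiffAt ℝ 2 d 0)
    (hmem : ∀ᶠ y in 𝓝 0, b y ∈ Set.Icc (0 : ℝ) 1 ∧ d y ∈ Set.Icc (0 : ℝ) 1)
    (he : ∀ᶠ y in 𝓝 0, triEdge (a y) (a y) (b y) (c y) (d y) =
      triEdge (a 0) (a 0) (b 0) (c 0) (d 0))
    (ht : HasDerivAt (fun y => triTriangle (a y) (a y) (b y) (c y) (d y)) 0 0) {r : ℝ}
    (hs : HasDerivAt (fun y => triEntropy (a y) (a y) (b y) (c y) (d y)) r 0) : r = 0 := by
  by_contra hr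
  rcases lt_or_gt_of_ne hr with hneg | hpos
  -- If the entropy decreases along the path, the path is run backwards.
  · have n0 : -(0 : ℝ) = 0 := neg_zero
    have tn : Tendsto (fun y : ℝ => -y) (𝓝 0) (𝓝 0) :=
      Continuous.tendsto' (by fun_prop) _ _ (by simp)
    have cn : ∀ {f : ℝ → ℝ}, ContDiffAt ℝ 2 f 0 → ContDiffAt ℝ 2 (fun y => f (-y)) 0 :=
      fun hf => ContDiffAt.comp (0 : ℝ) (by simpa using hf) contDiffAt_id.neg
    have dn : ∀ {f : ℝ → ℝ} {f' : ℝ}, HasDerivAt f f' 0 → HasDerivAt (fun y => f (-y)) (-f') 0 := by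
      intro f f' hf
      have := HasDerivAt.comp (0 : ℝ) (by simpa using hf) (hasDerivAt_neg (0 : ℝ))
      simpa [Function.comp_def] using this
    obtain ⟨a', m', b', c', d', h1, h2, h3, h4, h5, h6, h7, h8⟩ :=
      exists_better_tripodal_of_pos (a := fun y => a (-y)) (b := fun y => b (-y))
        (c := fun y => c (-y)) (d := fun y => d (-y)) (by simpa) (by simpa using h.isB11.c_mem)
        (cn ha) (cn hb) (cn hc) (cn hd) (tn.eventually hmem) (by simpa using tn.eventually he)
        (by simpa using dn ht) (dn hs) (by linarith)
    simp only [neg_zero] at h6 h7 h8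
    exact absurd (h.maximal _ _ _ _ _ h1 h2 h3 h4 h5 h6 h7) (not_le.2 h8)
  · obtain ⟨a', m', b', c', d', h1, h2, h3, h4, h5, h6, h7, h8⟩ :=
      exists_better_tripodal_of_pos ha0 h.isB11.c_mem ha hb hc hd hmem he ht hs hpos
    exact absurd (h.maximal _ _ _ _ _ h1 h2 h3 h4 h5 h6 h7) (not_le.2 h8)

end

/-! ### There is no critical bipodal graphon -/

lemma contDiffAt_const_add_mul (u v x : ℝ) : ContDiffAt ℝ 2 (fun y : ℝ => u + y * v) x := by
  fun_prop

lemma hasDerivAt_const_add_mul (u v : ℝ) : HasDerivAt (fun y : ℝ => u + y * v) v 0 := by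
  simpa using ((hasDerivAt_id (0 : ℝ)).mul_const v).const_add u

lemma eventually_const_add_mul_mem_Icc {u : ℝ} (hu : u ∈ Set.Ioo (0 : ℝ) 1) (v : ℝ) :
    ∀ᶠ y : ℝ in 𝓝 0, u + y * v ∈ Set.Icc (0 : ℝ) 1 := by
  have t : Tendsto (fun y : ℝ => u + y * v) (𝓝 0) (𝓝 u) :=
    Continuous.tendsto' (by fun_prop) _ _ (by simp)
  exact (t.eventually (isOpen_Ioo.mem_nhds hu)).mono fun y hy => Set.Ioo_subset_Icc_self hy

lemma hasDerivAt_binEntropy_const_add_mul {u : ℝ} (hu : u ∈ Set.Ioo (0 : ℝ) 1) (v : ℝ) :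
    HasDerivAt (fun y : ℝ => Real.binEntropy (u + y * v)) (entropySlope u * v) 0 := by
  have h1 : HasDerivAt Real.binEntropy (entropySlope u) (u + 0 * v) := by
    simpa using hasDerivAt_binEntropy hu
  exact h1.comp (0 : ℝ) (hasDerivAt_const_add_mul u v)

lemma entropySlope_injOn : Set.InjOn entropySlope (Set.Ioo 0 1) := by
  intro x hx y hy hxy
  have := abs_sub_le_abs_entropySlope_sub hx hy
  rw [hxy, sub_self, abs_zero] at this
  exact sub_eq_zero.1 (abs_nonpos_iff.1 this)

/-! ### Case analysis according to which block values are 0 or 1 -/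

namespace IsCriticalBipodal

variable {a b c d : ℝ}

/-- An unbalanced bipartite graphon has less entropy than the balanced one of equal edge density:
with λ = 4c(1 - c) < 1, strict concavity and H(0) = 0 give λH(d) < H(λd). -/
lemma false_of_a_eq_zero_of_b_eq_zero (h : IsCriticalBipodal 0 0 c d) : False := by
  have hc := h.isB11.c_mem
  have hd := h.isB11.d_mem
  have hk : 0 < 1 - c := by linarith [hc.2]
  have hd0 : 0 < d := lt_of_le_of_ne hd.1 fun h0 => h.isB11.not_constant ⟨h0, h0⟩
  have hc2 : c ≠ 1 / 2 := fun h' => h.isB11.not_A20 ⟨rfl, h'⟩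
  have hl0 : 0 < 4 * c * (1 - c) := mul_pos (mul_pos (by norm_num) hc.1) hk
  have hl1 : 4 * c * (1 - c) < 1 := by
    have := sq_pos_of_ne_zero (sub_ne_zero.2 hc2)
    nlinarith
  have e : triEdge 0 0 0 c d = 2 * c * (1 - c) * d := by simp [triEdge]
  have hs := h.bipartite (by rw [e]; nlinarith [hd.2])
  have hH := Real.strictConcave_binEntropy.2 (show (0 : ℝ) ∈ Set.Icc 0 1 by simp) hd hd0.ne
    (show 0 < 1 - 4 * c * (1 - c) by linarith) hl0 (by ring)
  have e2 : 2 * triEdge 0 0 0 c d = 4 * c * (1 - c) * d := by rw [e]; ring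
  rw [e2] at hs
  simp [triEntropy] at hs hH
  linarith

/-- Mass is exchanged between the two diagonal blocks. -/
lemma false_of_d_eq_one (h : IsCriticalBipodal a b c 1) (ha : a ∈ Set.Ioo (0 : ℝ) 1)
    (hb : b ∈ Set.Ioo (0 : ℝ) 1) : False := by
  have hc := h.isB11.c_mem
  have hk : 0 < 1 - c := by linarith [hc.2]
  have hc0 := hc.1.ne'
  have hk0 := hk.ne'
  have hAB : c * a ^ 2 + (1 - c) * 1 ^ 2 = c * 1 ^ 2 + (1 - c) * b ^ 2 := by
    refine le_antisymm (not_lt.1 fun h' => ?_) (not_lt.1 fun h' => ?_)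
    · rcases h.ab h' with h0 | h0
      exacts [ha.1.ne' h0, hb.2.ne h0]
    · rcases h.ba h' with h0 | h0
      exacts [hb.1.ne' h0, ha.2.ne h0]
  have hne : a ≠ b := by
    rintro rfl
    have : (2 * c - 1) * (1 - a ^ 2) = 0 := by linear_combination -hAB
    rcases mul_eq_zero.1 this with h0 | h0
    · exact h.isB11.not_A20 ⟨rfl, by linarith⟩
    · nlinarith [ha.1, ha.2]
  -- Steps inverse to the block areas fix the edge density; equality of the codegrees makes the
  -- triangle density stationary.
  have hs0 := IsCriticalBipodal.eq_zero_of_hasDerivAt (a := fun y => a + y * (c ^ 2)⁻¹)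
    (b := fun y => b + y * (-((1 - c) ^ 2)⁻¹)) (c := fun _ => c) (d := fun _ => 1)
    (by simpa using h) (by simpa using ha) (contDiffAt_const_add_mul _ _ _)
    (contDiffAt_const_add_mul _ _ _) contDiffAt_const contDiffAt_const
    ((eventually_const_add_mul_mem_Icc hb _).and (by simp))
    (Eventually.of_forall fun y => by simp only [triEdge]; field_simp; ring)
    ((hasDerivAt_triTriangle (hasDerivAt_const_add_mul ..) (hasDerivAt_const_add_mul ..)
      (hasDerivAt_const_add_mul ..) (hasDerivAt_const ..) (hasDerivAt_const ..)).congr_deriv (by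
        simp only [zero_mul, add_zero]
        field_simp
        linear_combination 96 * hAB))
    (hasDerivAt_triEntropy_of_hasDerivAt (hasDerivAt_binEntropy_const_add_mul ha _)
      (hasDerivAt_binEntropy_const_add_mul ha _) (hasDerivAt_binEntropy_const_add_mul hb _)
      (hasDerivAt_const ..) (hasDerivAt_const ..))
  have : entropySlope a = entropySlope b := by
    field_simp at hs0
    linarith
  exact hne (entropySlope_injOn ha hb this)

/-- Mass is exchanged between a diagonal block and the off-diagonal blocks. -/
lemma false_of_b_eq_zero (h : IsCriticalBipodal a 0 c d) (ha : a ∈ Set.Ioo (0 : ℝ) 1)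
    (hd : d ∈ Set.Ioo (0 : ℝ) 1) : False := by
  have hc := h.isB11.c_mem
  have hk : 0 < 1 - c := by linarith [hc.2]
  have hc0 := hc.1.ne'
  have hk0 := hk.ne'
  have hAD : c * a ^ 2 + (1 - c) * d ^ 2 = c * a * d + (1 - c) * d * 0 := by
    refine le_antisymm (not_lt.1 fun h' => ?_) (not_lt.1 fun h' => ?_)
    · rcases h.ad h' with h0 | h0
      exacts [ha.1.ne' h0, hd.2.ne h0]
    · rcases h.da h' with h0 | h0
      exacts [hd.1.ne' h0, ha.2.ne h0]
  have hne : a ≠ d := by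
    rintro rfl
    have : (1 - c) * a ^ 2 = 0 := by linear_combination hAD
    exact (mul_pos hk (pow_pos ha.1 2)).ne' this
  have hs0 := IsCriticalBipodal.eq_zero_of_hasDerivAt (a := fun y => a + y * (c ^ 2)⁻¹)
    (b := fun _ => 0) (c := fun _ => c) (d := fun y => d + y * (-(2 * c * (1 - c))⁻¹))
    (by simpa using h) (by simpa using ha) (contDiffAt_const_add_mul _ _ _)
    contDiffAt_const contDiffAt_const (contDiffAt_const_add_mul _ _ _)
    (Eventually.and (by simp) (eventually_const_add_mul_mem_Icc hd _))
    (Eventually.of_forall fun y => by simp only [triEdge]; field_simp; ring)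
    ((hasDerivAt_triTriangle (hasDerivAt_const_add_mul ..) (hasDerivAt_const_add_mul ..)
      (hasDerivAt_const ..) (hasDerivAt_const ..) (hasDerivAt_const_add_mul ..)).congr_deriv (by
        simp only [zero_mul, add_zero]
        field_simp
        linear_combination 96 * hAD))
    (hasDerivAt_triEntropy_of_hasDerivAt (hasDerivAt_binEntropy_const_add_mul ha _)
      (hasDerivAt_binEntropy_const_add_mul ha _) (hasDerivAt_const ..)
      (hasDerivAt_const ..) (hasDerivAt_binEntropy_const_add_mul hd _))
  have : entropySlope a = entropySlope d := by
    field_simp at hs0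
    linarith
  exact hne (entropySlope_injOn ha hd this)

/-- The sizes of the podes change. -/
lemma false_of_b_eq_zero_of_d_eq_one (h : IsCriticalBipodal a 0 c 1)
    (ha : a ∈ Set.Ioo (0 : ℝ) 1) : False := by
  have hc := h.isB11.c_mem
  have hk : 0 < 1 - c := by linarith [hc.2]
  have hc0 := hc.1.ne'
  have hsize := h.size_a ha
  -- Otherwise the codegree of the first pode exceeds that of the second, forcing a = 0 or b = 1.
  have hck : 1 - c < c := by
    by_contra hle
    have hpos : 0 < c * a ^ 2 := mul_pos hc.1 (pow_pos ha.1 2)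
    rcases h.ab (by linarith) with h0 | h0
    · exact ha.1.ne' h0
    · exact zero_ne_one h0
  -- As the first pode grows, its value `A` is adjusted to keep the edge density; `hsize` says
  -- exactly that the triangle density is stationary on this path.
  let N : ℝ → ℝ := fun y => c ^ 2 * a + 2 * c * (1 - c) - 2 * (c + y * 1) * (1 - (c + y * 1))
  let A : ℝ → ℝ := fun y => N y / (c + y * 1) ^ 2
  have hN : HasDerivAt N (-2 * (1 - 2 * c)) 0 := by
    have h1 := hasDerivAt_const_add_mul c 1
    have := ((h1.const_mul 2).mul (h1.const_sub 1)).const_sub (c ^ 2 * a + 2 * c * (1 - c))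
    refine HasDerivAt.congr_deriv (f := N) this ?_
    simp; ring
  have hA0 : A 0 = a := by
    simp only [A, N, mul_one, add_zero]
    field_simp
    ring
  have hA : HasDerivAt A (-(2 * c * a + 2 * (1 - 2 * c)) / c ^ 2) 0 := by
    have h1 := (hasDerivAt_const_add_mul c 1).pow 2
    have := hN.div h1 (by simpa using hc0)
    refine HasDerivAt.congr_deriv (f := A) this ?_
    simp [N]
    field_simp
    ring
  have hH : HasDerivAt Real.binEntropy (entropySlope a) (A 0) := by
    rw [hA0]; exact hasDerivAt_binEntropy ha
  have hAc : ContDiffAt ℝ 2 A 0 := by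
    have h1 : ((c : ℝ) + 0 * 1) ^ 2 ≠ 0 := by simpa using hc0
    have h2 : ContDiffAt ℝ 2 N 0 := by fun_prop
    exact h2.div (by fun_prop) h1
  have hev : ∀ᶠ y : ℝ in 𝓝 0, c + y * 1 ≠ 0 := by
    have t : Tendsto (fun y : ℝ => c + y * 1) (𝓝 0) (𝓝 c) :=
      Continuous.tendsto' (by fun_prop) _ _ (by simp)
    exact t.eventually_ne hc0
  have hs0 := IsCriticalBipodal.eq_zero_of_hasDerivAt (a := A)
    (b := fun _ => 0) (c := fun y => c + y * 1) (d := fun _ => 1)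
    (by simpa [hA0] using h) (by rwa [hA0]) hAc
    contDiffAt_const (contDiffAt_const_add_mul _ _ _) contDiffAt_const
    (by simp)
    (hev.mono fun y hy => by
      rw [mul_one] at hy
      simp only [triEdge, A, N, mul_one, add_zero]
      field_simp
      ring)
    ((hasDerivAt_triTriangle hA hA
      (hasDerivAt_const ..) (hasDerivAt_const_add_mul ..) (hasDerivAt_const ..)).congr_deriv (by
        simp only [hA0, zero_mul, add_zero]
        field_simp
        linear_combination 16 * hsize))
    (hasDerivAt_triEntropy_of_hasDerivAt
      (hH.comp (0 : ℝ) hA) (hH.comp (0 : ℝ) hA)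
      (hasDerivAt_const ..)
      (hasDerivAt_const_add_mul ..) (hasDerivAt_const ..))
  have hla : Real.log a < 0 := Real.log_neg ha.1 ha.2
  have hlb : Real.log (1 - a) < 0 := Real.log_neg (by linarith [ha.2]) (by linarith [ha.1])
  simp only [hA0, add_zero, mul_zero, mul_one, Real.binEntropy_zero,
    Real.binEntropy_one, sub_zero] at hs0
  field_simp at hs0
  simp only [Real.binEntropy, Real.log_inv, entropySlope] at hs0
  -- The entropy derivative works out to (2c - 1)(-log a) + (1 - c)(-log(1 - a)), which is positive.
  have p1 := mul_pos (sub_pos.2 hck) (neg_pos.2 hla)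
  have p2 := mul_pos hk (neg_pos.2 hlb)
  nlinarith

/-- Codegrees alone suffice. Comparing the a- and d-blocks gives b > d; comparing the b- and
d-blocks then gives b ≤ d², which is less than d. -/
lemma false_of_a_eq_one (h : IsCriticalBipodal 1 b c d) (hd : d ∈ Set.Ioo (0 : ℝ) 1) : False := by
  have hc := h.isB11.c_mem
  have hk : 0 < 1 - c := by linarith [hc.2]
  have hb := h.isB11.b_mem
  have hAD : c * 1 ^ 2 + (1 - c) * d ^ 2 ≤ c * 1 * d + (1 - c) * d * b := by
    refine not_lt.1 fun h' => ?_
    rcases h.ad h' with h0 | h0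
    exacts [one_ne_zero h0, hd.2.ne h0]
  have hcd : 0 < c * (1 - d) := mul_pos hc.1 (sub_pos.2 hd.2)
  have hbd : d < b := by
    by_contra! hle
    have := mul_le_mul_of_nonneg_left hle (mul_pos hk hd.1).le
    nlinarith
  have hBD : c * d ^ 2 + (1 - c) * b ^ 2 ≤ c * 1 * d + (1 - c) * d * b := by
    refine not_lt.1 fun h' => ?_
    rcases h.bd h' with h0 | h0
    · linarith [hd.1]
    · exact hd.2.ne h0
  have h1 : c * (1 - d) ≤ (1 - c) * d * (b - d) := by linarith
  have h2 : (1 - c) * b * (b - d) ≤ d * (c * (1 - d)) := by linarith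
  have h3 := mul_le_mul_of_nonneg_left h1 hd.1.le
  have h4 : b * ((1 - c) * (b - d)) ≤ d ^ 2 * ((1 - c) * (b - d)) := by linarith
  have h5 := le_of_mul_le_mul_right h4 (mul_pos hk (sub_pos.2 hbd))
  nlinarith [hd.1, hd.2]

/-- All codegrees agree, so a = d or ab = d². Since a - d and b - d have the same sign, the second
is impossible unless a = d, and then b = d too. -/
lemma false_of_mem_Ioo (h : IsCriticalBipodal a b c d) (ha : a ∈ Set.Ioo (0 : ℝ) 1)
    (hb : b ∈ Set.Ioo (0 : ℝ) 1) (hd : d ∈ Set.Ioo (0 : ℝ) 1) : False := by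
  have hc := h.isB11.c_mem
  have hk : 0 < 1 - c := by linarith [hc.2]
  have hAD : c * a ^ 2 + (1 - c) * d ^ 2 = c * a * d + (1 - c) * d * b := by
    refine le_antisymm (not_lt.1 fun h' => ?_) (not_lt.1 fun h' => ?_)
    · rcases h.ad h' with h0 | h0
      exacts [ha.1.ne' h0, hd.2.ne h0]
    · rcases h.da h' with h0 | h0
      exacts [hd.1.ne' h0, ha.2.ne h0]
  have hBD : c * d ^ 2 + (1 - c) * b ^ 2 = c * a * d + (1 - c) * d * b := by
    refine le_antisymm (not_lt.1 fun h' => ?_) (not_lt.1 fun h' => ?_)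
    · rcases h.bd h' with h0 | h0
      exacts [hb.1.ne' h0, hd.2.ne h0]
    · rcases h.db h' with h0 | h0
      exacts [hd.1.ne' h0, hb.2.ne h0]
  have h1 : c * a * (a - d) = (1 - c) * d * (b - d) := by linear_combination hAD
  have h2 : c * d * (a - d) = (1 - c) * b * (b - d) := by linear_combination -hBD
  have p1 : 0 < c * a := mul_pos hc.1 ha.1
  have p2 : 0 < (1 - c) * d := mul_pos hk hd.1
  have p3 : 0 < c * d := mul_pos hc.1 hd.1
  have p4 : 0 < (1 - c) * b := mul_pos hk hb.1
  have h3 : c * (a - d) * (a * b - d ^ 2) = 0 := by linear_combination b * h1 - d * h2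
  rcases lt_trichotomy a d with h4 | h4 | h4
  · have h5 : b < d := by
      by_contra! hle
      have := mul_nonneg p2.le (sub_nonneg.2 hle)
      have := mul_neg_of_pos_of_neg p1 (sub_neg.2 h4)
      linarith
    have h6 : a * b < d ^ 2 := by nlinarith [ha.1, hb.1]
    exact (mul_pos_of_neg_of_neg (mul_neg_of_pos_of_neg hc.1 (sub_neg.2 h4)) (sub_neg.2 h6)).ne' h3
  · have h5 : (1 - c) * d * (b - d) = 0 := by rw [← h1, h4]; ring
    have h6 := (mul_eq_zero.1 h5).resolve_left p2.ne'
    exact h.isB11.not_constant ⟨h4, by linarith⟩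
  · have h5 : d < b := by
      by_contra! hle
      have := mul_nonneg p2.le (sub_nonneg.2 hle)
      have := mul_pos p1 (sub_pos.2 h4)
      linarith
    have h6 : d ^ 2 < a * b := by nlinarith [hd.1]
    exact (mul_pos (mul_pos hc.1 (sub_pos.2 h4)) (sub_pos.2 h6)).ne' h3

lemma false_of_d_eq_zero (h : IsCriticalBipodal a b c 0) : False := by
  have hc := h.isB11.c_mem
  have hk : 0 < 1 - c := by linarith [hc.2]
  have ha : a = 0 := by
    by_contra h0
    have hpos : 0 < c * a ^ 2 := mul_pos hc.1 (pow_pos (lt_of_le_of_ne h.isB11.a_mem.1 (Ne.symm h0)) 2)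
    rcases h.ad (by linarith) with h1 | h1
    exacts [h0 h1, zero_ne_one h1]
  have hb : b = 0 := by
    by_contra h0
    have hpos : 0 < (1 - c) * b ^ 2 :=
      mul_pos hk (pow_pos (lt_of_le_of_ne h.isB11.b_mem.1 (Ne.symm h0)) 2)
    rcases h.bd (by linarith) with h1 | h1
    exacts [h0 h1, zero_ne_one h1]
  exact h.isB11.not_constant ⟨ha, hb⟩

lemma false_of_a_eq_one_of_d_eq_one (h : IsCriticalBipodal 1 b c 1) : False := by
  have hc := h.isB11.c_mem
  have hk : 0 < 1 - c := by linarith [hc.2]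
  have hb1 : b ≠ 1 := fun h' => h.isB11.not_constant ⟨rfl, h'⟩
  have hb : b < 1 := lt_of_le_of_ne h.isB11.b_mem.2 hb1
  have hb2 : b ^ 2 < 1 := by nlinarith [h.isB11.b_mem.1]
  rcases h.ab (by nlinarith) with h0 | h0
  exacts [one_ne_zero h0, hb1 h0]

lemma eq_zero_or_mem_Ioo_or_eq_one {x : ℝ} (hx : x ∈ Set.Icc (0 : ℝ) 1) :
    x = 0 ∨ x ∈ Set.Ioo (0 : ℝ) 1 ∨ x = 1 := by
  rcases hx.1.eq_or_lt with h0 | h0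
  · exact Or.inl h0.symm
  · rcases hx.2.eq_or_lt with h1 | h1
    exacts [Or.inr (Or.inr h1), Or.inr (Or.inl ⟨h0, h1⟩)]

/-- Exchanging the podes halves the table of cases: `swap` reduces each pattern to its mirror image.
-/
theorem elim (h : IsCriticalBipodal a b c d) : False := by
  rcases eq_zero_or_mem_Ioo_or_eq_one h.isB11.d_mem with rfl | hd | rfl
  · exact h.false_of_d_eq_zero
  · rcases eq_zero_or_mem_Ioo_or_eq_one h.isB11.a_mem with rfl | ha | rfl
    · rcases eq_zero_or_mem_Ioo_or_eq_one h.isB11.b_mem with rfl | hb | rfl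
      exacts [h.false_of_a_eq_zero_of_b_eq_zero, h.swap.false_of_b_eq_zero hb hd,
        h.swap.false_of_a_eq_one hd]
    · rcases eq_zero_or_mem_Ioo_or_eq_one h.isB11.b_mem with rfl | hb | rfl
      exacts [h.false_of_b_eq_zero ha hd, h.false_of_mem_Ioo ha hb hd, h.swap.false_of_a_eq_one hd]
    · exact h.false_of_a_eq_one hd
  · rcases eq_zero_or_mem_Ioo_or_eq_one h.isB11.a_mem with rfl | ha | rfl
    · rcases eq_zero_or_mem_Ioo_or_eq_one h.isB11.b_mem with rfl | hb | rfl
      exacts [h.false_of_a_eq_zero_of_b_eq_zero, h.swap.false_of_b_eq_zero_of_d_eq_one hb,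
        h.swap.false_of_a_eq_one_of_d_eq_one]
    · rcases eq_zero_or_mem_Ioo_or_eq_one h.isB11.b_mem with rfl | hb | rfl
      exacts [h.false_of_b_eq_zero_of_d_eq_one ha, h.false_of_d_eq_one ha hb,
        h.swap.false_of_a_eq_one_of_d_eq_one]
    · exact h.false_of_a_eq_one_of_d_eq_one

end IsCriticalBipodal

/-- Optimizers in a `B(2,1)` or `C(1,2)` phase never converge to a graphon of type `B(1,1)`. -/
theorem IsB21orC12Phase.not_isLimitOfOptimizers {V : Set (ℝ × ℝ)} (hV : IsB21orC12Phase V)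
    {p₀ : ℝ × ℝ} {a b c d : ℝ} (h : IsB11 a b c d) :
    ¬ IsLimitOfOptimizers V p₀ (bipodal a b c d) := by
  intro hlim
  obtain ⟨_, _, _, _, _, _, _, _, _, _, _, hm⟩ := exists_isMergingSequence hV h hlim
  exact hm.isCriticalBipodal.elim

end EdgeTriangle

end

theorem mainTheorem1 :
    {ε : ℝ | ∃ (τ : ℝ) (U V : Set (ℝ × ℝ)),
      EdgeTriangle.IsB11Phase U ∧ EdgeTriangle.IsB21orC12Phase V ∧
        EdgeTriangle.IsContinuousTransition U V (ε, τ)}.Finite := by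
  -- No value of ε has to be excluded.
  convert Set.finite_empty
  refine Set.eq_empty_of_forall_notMem ?_
  rintro ε ⟨τ, U, V, -, hV, a, b, c, d, hB, -, hlim⟩
  exact hV.not_isLimitOfOptimizers hB hlim
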